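/- Let $\Phi=\{\varphi_a:[0,1]\to[0,1]\}_{a\in\mathcal A}$ be a countable (possibly finite) family of similarities $\varphi_a(x)=r_ax+t_a$ with $0<|r_a|<1$ and $\sup_{a\in\mathcal A}|r_a|<1$, and suppose that the maps $\varphi_a$ do not all share a common fixed point. Let $\mathbf p=(p_a)_{a\in\mathcal A}$ be a probability vector, with $p_a>0$ for all $a$ and $\sum_{a}p_a=1$, and assume that \[\sum_{a\in\mathcal A}p_a|r_a|^{-\tau}<\infty\quad\text{for some }\tau>0.\] Let $\mu$ be the stationary measure for $\Phi$ and $\mathbf p$, that is, the unique Borel probability measure on $[0,1]$ with $\mu=\sum_{a\in\mathcal A}p_a\,\varphi_a\mu$, where $\varphi_a\mu$ denotes the pushforward of $\mu$ under $\varphi_a$. For a Borel probability measure $\nu$ on $\mathbb R$ write $\widehat\nu(\xi)=\int_{\mathbb R}e^{-2\pi i\xi x}\,d\nu(x)$, and let $F\mu$ denote the pushforward of $\mu$ under $F$. Then there exist $\eta,\kappa,C>0$, depending only on $\Phi$ and $\mathbf p$, such that the following two statements hold. 1. For every $C^2$ function $F:[0,1]\to\mathbb R$ with $F''(x)\neq0$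 for all $x\in[0,1]$, and for every real $\xi\neq0$, \[|\widehat{F\mu}(\xi)|\le C\Big(1+\max_{[0,1]}|F'|+\big(\max_{[0,1]}|F'|\big)^{-\kappa}+\max_{[0,1]}|F''|\Big)\Big(1+\big(\min_{[0,1]}|F''|\big)^{-\kappa}\Big)|\xi|^{-\eta}.\] 2. For every $C^2$ function $F:[0,1]\to\mathbb R$ with $F''(x)\neq0$ for all $x\in\operatorname{supp}(\mu)$ there exists $C_{F,\mu}>0$ such that $|\widehat{F\mu}(\xi)|\le C_{F,\mu}|\xi|^{-\eta}$ for all real $\xi\neq0$, with the same $\eta$ as above. -/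

import Mathlib

open MeasureTheory Set
open scoped unitInterval

/-- A countable family of maps of `[0,1]` is a countable iterated function system (CIFS) if its
members are contractions with a common contraction constant `ρ < 1`. -/
def IsCIFS {A : Type*} [Countable A] (φ : A → I → I) : Prop :=
  ∃ ρ : NNReal, ∀ a, ContractingWith ρ (φ a)

/-- `φ : [0,1] → [0,1]` is a similarity with (signed) contraction ratio `r`, that is,
`φ(x) = r x + t` for some `t`, where `0 < |r| < 1`. -/
def IsSimilarityWith (φ : I → I) (r : ℝ) : Prop :=
  0 < |r| ∧ |r| < 1 ∧ ∃ t : ℝ, ∀ x : I, (φ x : ℝ) = r * (x : ℝ) + t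

/-- The maps do not all share a common fixed point. -/
def IsNontrivialIFS {A : Type*} (φ : A → I → I) : Prop :=
  ¬ ∃ x : I, ∀ a, φ a x = x

/-- A probability vector with strictly positive weights. -/
def IsProbVector {A : Type*} (p : A → ℝ) : Prop :=
  (∀ a, 0 < p a) ∧ HasSum p 1

/-- `μ` is a Borel probability measure on `[0,1]` with `μ = ∑ₐ pₐ · φₐ μ`. -/
def IsStationaryMeasure {A : Type*} (φ : A → I → I) (p : A → ℝ) (μ : Measure I) : Prop :=
  IsProbabilityMeasure μ ∧
    μ = Measure.sum (fun a => ENNReal.ofReal (p a) • Measure.map (φ a) μ)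

/-- The Fourier transform `ν̂(ξ) = ∫ e^{-2πiξx} dν(x)` of a finite Borel measure on `ℝ`. -/
noncomputable def measureFourier (ν : Measure ℝ) (ξ : ℝ) : ℂ :=
  ∫ x : ℝ, Complex.exp (-(2 * Real.pi * Complex.I * ξ * x)) ∂ν

/-- The pushforward `Fμ` of a measure on `[0,1]` under (the restriction to `[0,1]` of) `F`. -/
noncomputable def pushforward (F : ℝ → ℝ) (μ : Measure I) : Measure ℝ :=
  Measure.map (fun x : I => F x) μ

/-- `F'` on `[0,1]`, one-sided at the endpoints. -/
noncomputable def deriv₁ (F : ℝ → ℝ) (x : I) : ℝ := derivWithin F (Icc 0 1) x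

/-- `F''` on `[0,1]`, one-sided at the endpoints. -/
noncomputable def deriv₂ (F : ℝ → ℝ) (x : I) : ℝ :=
  derivWithin (derivWithin F (Icc 0 1)) (Icc 0 1) x

/-- `max |F'|` over `[0,1]`; the supremum is attained for `F` of class `C²` on `[0,1]`. -/
noncomputable def maxDeriv₁ (F : ℝ → ℝ) : ℝ := ⨆ x : I, |deriv₁ F x|

/-- `max |F''|` over `[0,1]`; the supremum is attained for `F` of class `C²` on `[0,1]`. -/
noncomputable def maxDeriv₂ (F : ℝ → ℝ) : ℝ := ⨆ x : I, |deriv₂ F x|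

/-- `min |F''|` over `[0,1]`; the infimum is attained for `F` of class `C²` on `[0,1]`. -/
noncomputable def minDeriv₂ (F : ℝ → ℝ) : ℝ := ⨅ x : I, |deriv₂ F x|

/-! ### Concavity inequalities in `ℝ≥0∞` -/

theorem lintegral_rpow_le_rpow_lintegral {X : Type*} [MeasurableSpace X] {ν : Measure X}
    (hν : ν univ ≤ 1) {s : ℝ} (hs : 0 ≤ s) (hs1 : s ≤ 1) {f : X → ENNReal}
    (hf : AEMeasurable f ν) : ∫⁻ x, f x ^ s ∂ν ≤ (∫⁻ x, f x ∂ν) ^ s := by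
  have h := ENNReal.lintegral_mul_norm_pow_le (μ := ν) hf (aemeasurable_const (b := (1 : ENNReal)))
    hs (sub_nonneg.2 hs1) (by ring)
  simp only [ENNReal.one_rpow, mul_one, lintegral_const, one_mul] at h
  refine h.trans ?_
  calc _ ≤ (∫⁻ x, f x ∂ν) ^ s * 1 := by
        gcongr
        exact ENNReal.rpow_le_one hν (sub_nonneg.2 hs1)
    _ = _ := mul_one _

theorem tsum_mul_rpow_le_rpow_tsum {A : Type*} {w f : A → ENNReal} (hw : ∑' a, w a ≤ 1)
    {s : ℝ} (hs : 0 ≤ s) (hs1 : s ≤ 1) :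
    ∑' a, w a * f a ^ s ≤ (∑' a, w a * f a) ^ s := by
  let _ : MeasurableSpace A := ⊤
  have key : ∀ g : A → ENNReal,
      ∫⁻ a, g a ∂(Measure.sum fun a => w a • Measure.dirac a) = ∑' a, w a * g a := by
    intro g
    rw [lintegral_sum_measure]
    refine tsum_congr fun a => ?_
    rw [lintegral_smul_measure, lintegral_dirac, smul_eq_mul]
  rw [← key, ← key]
  refine lintegral_rpow_le_rpow_lintegral ?_ hs hs1 measurable_from_top.aemeasurable
  rw [Measure.sum_apply _ MeasurableSet.univ]
  simpa using hw

/-! ### Systems of similarities on the line -/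

/-- The maps `x ↦ r a * x + t a` are similarities of `[0,1]` with ratios at most `ρ` in absolute
value, `p` is a probability vector with a moment of order `τ`, and `μ` is stationary. -/
structure SimSys {A : Type*} (μ : Measure ℝ) (r t p : A → ℝ) (ρ τ : ℝ) : Prop where
  p_pos : ∀ a, 0 < p a
  p_sum : HasSum p 1
  r_ne : ∀ a, r a ≠ 0
  r_le : ∀ a, |r a| ≤ ρ
  mapsTo : ∀ a, ∀ x ∈ Icc (0 : ℝ) 1, r a * x + t a ∈ Icc (0 : ℝ) 1
  moment : Summable fun a => p a * |r a| ^ (-τ)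
  stationary : ∀ S, MeasurableSet S →
    μ S = ∑' a, ENNReal.ofReal (p a) * μ ((fun x => r a * x + t a) ⁻¹' S)

namespace SimSys

theorem unit (μ : Measure ℝ) (τ : ℝ) :
    SimSys μ (fun _ : PUnit => 1) (fun _ => 0) (fun _ => 1) 1 τ where
  p_pos _ := one_pos
  p_sum := by simp
  r_ne _ := one_ne_zero
  r_le _ := by simp
  mapsTo _ x hx := by simpa using hx
  moment := (hasSum_fintype _).summable
  stationary S _ := by simp

theorem prod {A B : Type*} {μ : Measure ℝ} {r t p : A → ℝ} {r' t' p' : B → ℝ} {ρ ρ' τ : ℝ}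
    (h : SimSys μ r t p ρ τ) (h' : SimSys μ r' t' p' ρ' τ) :
    SimSys μ (fun x : A × B => r x.1 * r' x.2) (fun x => r x.1 * t' x.2 + t x.1)
      (fun x => p x.1 * p' x.2) (ρ * ρ') τ where
  p_pos x := mul_pos (h.p_pos _) (h'.p_pos _)
  p_sum := by
    simpa using h.p_sum.mul h'.p_sum (h.p_sum.summable.mul_of_nonneg h'.p_sum.summable
      (fun a => (h.p_pos a).le) (fun a => (h'.p_pos a).le))
  r_ne x := mul_ne_zero (h.r_ne _) (h'.r_ne _)
  r_le x := by
    rw [abs_mul]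
    exact mul_le_mul (h.r_le _) (h'.r_le _) (abs_nonneg _) ((abs_nonneg _).trans (h.r_le x.1))
  mapsTo x y hy := by
    have := h.mapsTo x.1 _ (h'.mapsTo x.2 y hy)
    convert this using 1
    ring
  moment := by
    have := h.moment.mul_of_nonneg h'.moment
      (fun a => mul_nonneg (h.p_pos a).le (by positivity))
      (fun a => mul_nonneg (h'.p_pos a).le (by positivity))
    refine this.congr fun x => ?_
    rw [abs_mul, Real.mul_rpow (abs_nonneg _) (abs_nonneg _)]
    ring
  stationary S hS := by
    rw [h.stationary S hS, ENNReal.tsum_prod (f := fun a b => ENNReal.ofReal (p a * p' b) *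
      μ ((fun x => r a * r' b * x + (r a * t' b + t a)) ⁻¹' S))]
    refine tsum_congr fun a => ?_
    rw [h'.stationary _ (by measurability), ← ENNReal.tsum_mul_left]
    refine tsum_congr fun b => ?_
    rw [← mul_assoc, ← ENNReal.ofReal_mul (h.p_pos a).le, ← preimage_comp]
    congr 3
    ext x
    simp only [Function.comp]
    ring

section

variable {A : Type*} {μ : Measure ℝ} {r t p : A → ℝ} {ρ τ : ℝ}

theorem tsum_p (h : SimSys μ r t p ρ τ) : ∑' a, ENNReal.ofReal (p a) = 1 := by
  rw [← ENNReal.ofReal_tsum_of_nonneg (fun a => (h.p_pos a).le) h.p_sum.summable, h.p_sum.tsum_eq,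
    ENNReal.ofReal_one]

theorem eq_sum (h : SimSys μ r t p ρ τ) :
    μ = Measure.sum fun a => ENNReal.ofReal (p a) • μ.map fun x => r a * x + t a := by
  ext S hS
  rw [Measure.sum_apply _ hS, h.stationary S hS]
  refine tsum_congr fun a => ?_
  rw [Measure.smul_apply, Measure.map_apply (by fun_prop) hS, smul_eq_mul]

theorem hasSum_integral (h : SimSys μ r t p ρ τ) [IsFiniteMeasure μ] {f : ℝ → ℂ}
    (hf : Continuous f) (hf1 : ∀ x, ‖f x‖ ≤ 1) :
    HasSum (fun a => (p a : ℂ) * ∫ x, f (r a * x + t a) ∂μ) (∫ x, f x ∂μ) := by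
  have hi : Integrable f μ :=
    Integrable.of_bound hf.aestronglyMeasurable 1 (Filter.Eventually.of_forall hf1)
  have hi' := hi
  rw [h.eq_sum] at hi'
  have := hasSum_integral_measure hi'
  rw [← h.eq_sum] at this
  refine this.congr_fun fun a => ?_
  rw [integral_smul_measure, integral_map (by fun_prop) hf.aestronglyMeasurable,
    ENNReal.toReal_ofReal (h.p_pos a).le, Complex.real_smul]

/-- Averaging over an involution of the alphabet that preserves the weights. -/
theorem enorm_integral_le (h : SimSys μ r t p ρ τ) [IsFiniteMeasure μ] (e : Equiv.Perm A)
    (he : ∀ a, p (e a) = p a) {f : ℝ → ℂ} (hf : Continuous f) (hf1 : ∀ x, ‖f x‖ ≤ 1) :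
    ‖∫ x, f x ∂μ‖ₑ ≤ ∑' a, ENNReal.ofReal (p a) *
      ‖∫ x, (f (r a * x + t a) + f (r (e a) * x + t (e a))) / 2 ∂μ‖ₑ := by
  have h1 := h.hasSum_integral hf hf1
  have h2 := e.hasSum_iff.2 h1
  have h3 := (h1.add h2).div_const 2
  rw [add_self_div_two] at h3
  rw [← h3.tsum_eq]
  refine enorm_tsum_le_tsum_enorm.trans (ENNReal.tsum_le_tsum fun a => le_of_eq ?_)
  have hi : ∀ a, Integrable (fun x => f (r a * x + t a)) μ := fun a =>
    Integrable.of_bound (by fun_prop) 1 (Filter.Eventually.of_forall fun x => hf1 _)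
  rw [integral_div, integral_add (hi a) (hi _)]
  simp only [Function.comp, he]
  rw [← mul_add, mul_div_assoc, enorm_mul]
  congr 1
  rw [← ofReal_norm, Complex.norm_real, Real.norm_of_nonneg (h.p_pos a).le]

end

end SimSys

/-- Two letters with the same ratio and the same weight whose images of `[0,1]` are separated. -/
structure IsTwin {A : Type*} (r t p : A → ℝ) (u v : A) (g : ℝ) : Prop where
  ne : u ≠ v
  r_eq : r u = r v
  p_eq : p u = p v
  gap_pos : 0 < g
  gap_le : ∀ x ∈ Icc (0 : ℝ) 1, ∀ y ∈ Icc (0 : ℝ) 1, g ≤ |r u * x + t u - (r v * y + t v)|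

theorem IsTwin.symm {A : Type*} {r t p : A → ℝ} {u v : A} {g : ℝ} (h : IsTwin r t p u v g) :
    IsTwin r t p v u g where
  ne := h.ne.symm
  r_eq := h.r_eq.symm
  p_eq := h.p_eq.symm
  gap_pos := h.gap_pos
  gap_le x hx y hy := by
    rw [abs_sub_comm]
    exact h.gap_le y hy x hx

theorem IsTwin.sub_ne_zero {A : Type*} {r t p : A → ℝ} {u v : A} {g : ℝ}
    (h : IsTwin r t p u v g) : t u - t v ≠ 0 := by
  have := h.gap_le 0 (by simp) 0 (by simp)
  intro h0
  simp only [mul_zero, zero_add, h0, abs_zero] at this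
  exact absurd this (not_le.2 h.gap_pos)

namespace SimSys

/-- The iterates `a^m` and `b^m` of two letters occur as letters of the `m`-fold system. -/
theorem exists_pow.{w} {A : Type w} [Countable A] {μ : Measure ℝ} {r t p : A → ℝ} {ρ τ : ℝ}
    (h : SimSys μ r t p ρ τ) (a b : A) (m : ℕ) :
    ∃ (B : Type w) (_ : Countable B) (r' t' p' : B → ℝ), SimSys μ r' t' p' (ρ ^ m) τ ∧
      ∃ x y : B, (∀ s, r' x * s + t' x = (fun s => r a * s + t a)^[m] s) ∧
        (∀ s, r' y * s + t' y = (fun s => r b * s + t b)^[m] s) := by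
  induction m with
  | zero =>
    refine ⟨PUnit, inferInstance, _, _, _, by simpa using SimSys.unit μ τ, .unit, .unit, ?_, ?_⟩ <;>
      simp
  | succ m ih =>
    obtain ⟨B, hB, r', t', p', hs, x, y, hx, hy⟩ := ih
    refine ⟨A × B, inferInstance, _, _, _, by simpa [pow_succ'] using h.prod hs, (a, x), (b, y),
      fun s => ?_, fun s => ?_⟩
    · rw [Function.iterate_succ_apply', ← hx]
      ring
    · rw [Function.iterate_succ_apply', ← hy]
      ring

theorem exists_twin.{w} {A : Type w} [Countable A] {μ : Measure ℝ} {r t p : A → ℝ} {ρ τ : ℝ}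
    (h : SimSys μ r t p ρ τ) (hρ : 0 < ρ) (hρ1 : ρ < 1) (a b : A) {x₀ y₀ : ℝ}
    (hx : x₀ ∈ Icc (0 : ℝ) 1) (hy : y₀ ∈ Icc (0 : ℝ) 1) (hne : x₀ ≠ y₀)
    (hxa : r a * x₀ + t a = x₀) (hyb : r b * y₀ + t b = y₀) :
    ∃ (B : Type w) (_ : Countable B) (r' t' p' : B → ℝ) (ρ' : ℝ), 0 < ρ' ∧ ρ' < 1 ∧
      SimSys μ r' t' p' ρ' τ ∧ ∃ u v g, IsTwin r' t' p' u v g := by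
  have hd : 0 < |x₀ - y₀| := abs_pos.2 (sub_ne_zero.2 hne)
  obtain ⟨m, hm⟩ := exists_pow_lt_of_lt_one (show 0 < |x₀ - y₀| / 3 by positivity) hρ1
  have hle : |x₀ - y₀| ≤ 1 := by
    rw [abs_le]; constructor <;> linarith [hx.1, hx.2, hy.1, hy.2]
  obtain ⟨B, hB, r', t', p', hs, x, y, hx', hy'⟩ := h.exists_pow a b m
  have hm1 : ρ ^ m < 1 := by linarith
  have near : ∀ (c : A) (z : B) (z₀ : ℝ), r c * z₀ + t c = z₀ → z₀ ∈ Icc (0 : ℝ) 1 →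
      (∀ s, r' z * s + t' z = (fun s => r c * s + t c)^[m] s) →
      ∀ s ∈ Icc (0 : ℝ) 1, |r' z * s + t' z - z₀| ≤ ρ ^ m := by
    intro c z z₀ hz hz₀ hzz s hs'
    have h1 : r' z * z₀ + t' z = z₀ := by
      rw [hzz]
      exact Function.iterate_fixed hz m
    have h2 : r' z * s + t' z - z₀ = r' z * (s - z₀) := by linear_combination h1
    rw [h2, abs_mul]
    have h3 : |s - z₀| ≤ 1 := by
      rw [abs_le]; constructor <;> linarith [hs'.1, hs'.2, hz₀.1, hz₀.2]
    calc _ ≤ ρ ^ m * 1 := mul_le_mul (hs.r_le z) h3 (abs_nonneg _) (by positivity)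
      _ = _ := mul_one _
  refine ⟨B × B, inferInstance, _, _, _, ρ ^ m * ρ ^ m, by positivity,
    by nlinarith [pow_pos hρ m], hs.prod hs,
    (x, y), (y, x), |x₀ - y₀| / 3, ?_, mul_comm _ _, mul_comm _ _, by positivity, ?_⟩
  · intro hxy
    have hxy' : x = y := (Prod.mk.inj hxy).1
    have h1 := near a x x₀ hxa hx hx' 0 (by simp)
    have h2 := near b y y₀ hyb hy hy' 0 (by simp)
    rw [← hxy'] at h2
    have h3 := abs_sub_le x₀ (r' x * 0 + t' x) y₀
    rw [abs_sub_comm x₀ (r' x * 0 + t' x)] at h3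
    linarith
  · intro s hs1 s' hs1'
    have h1 := near a x x₀ hxa hx hx' _ (hs.mapsTo y s hs1)
    have h2 := near b y y₀ hyb hy hy' _ (hs.mapsTo x s' hs1')
    simp only
    have h3 : r' x * r' y * s + (r' x * t' y + t' x) - (r' y * r' x * s' + (r' y * t' x + t' y))
      = (r' x * (r' y * s + t' y) + t' x - x₀) - (r' y * (r' x * s' + t' x) + t' y - y₀)
        + (x₀ - y₀) := by ring
    rw [h3]
    rw [abs_le] at h1 h2
    rcases abs_cases (x₀ - y₀) with h4 | h4 <;> rw [le_abs]
    · left; linarith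
    · right; linarith

end SimSys

/-! ### The character `x ↦ e^{-2πix}` -/

/-- The character `x ↦ e^{-2πix}`. -/
noncomputable def ch (x : ℝ) : ℂ := Complex.exp (-(2 * Real.pi * Complex.I * x))

theorem ch_eq (x : ℝ) : ch x = Complex.exp (Complex.I * ((-(2 * Real.pi * x) : ℝ) : ℂ)) := by
  unfold ch
  congr 1
  push_cast
  ring

theorem norm_ch (x : ℝ) : ‖ch x‖ = 1 := by
  rw [ch_eq, Complex.norm_exp_I_mul_ofReal]

theorem ch_add (x y : ℝ) : ch (x + y) = ch x * ch y := by
  unfold ch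
  rw [← Complex.exp_add]
  congr 1
  push_cast
  ring

@[fun_prop]
theorem continuous_ch : Continuous ch := by
  unfold ch
  fun_prop

theorem norm_ch_sub_le (x y : ℝ) : ‖ch x - ch y‖ ≤ 2 * Real.pi * |x - y| := by
  have h : ch x - ch y = ch y * (ch (x - y) - 1) := by
    rw [mul_sub, ← ch_add]
    simp
  rw [h, norm_mul, norm_ch, one_mul, ch_eq]
  refine Real.norm_exp_I_mul_ofReal_sub_one_le.trans (le_of_eq ?_)
  rw [Real.norm_eq_abs, abs_neg, abs_mul, abs_of_pos Real.two_pi_pos]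

theorem norm_ch_add_div_two (x y : ℝ) :
    ‖(ch x + ch y) / 2‖ = |Real.cos (Real.pi * (x - y))| := by
  have h : (ch x + ch y) / 2 = ch ((x + y) / 2) * ((Real.cos (Real.pi * (x - y)) : ℝ) : ℂ) := by
    rw [Complex.ofReal_cos, Complex.cos, ch, ch, ch, mul_div_assoc', mul_add, ← Complex.exp_add,
      ← Complex.exp_add, add_comm]
    congr 3 <;> push_cast <;> ring
  rw [h, norm_mul, norm_ch, one_mul, Complex.norm_real, Real.norm_eq_abs]

/-- The modulus of the Fourier transform of the average of two point masses. -/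
noncomputable def cosFactor {A : Type*} (t : A → ℝ) (e : Equiv.Perm A) (a : A) (s : ℝ) : ENNReal :=
  ENNReal.ofReal |Real.cos (Real.pi * ((t a - t (e a)) * s))|

theorem measurable_cosFactor {A : Type*} (t : A → ℝ) (e : Equiv.Perm A) (a : A) :
    Measurable (cosFactor t e a) := by
  unfold cosFactor
  fun_prop

/-- The modulus of the Fourier transform of `μ`. -/
noncomputable def fourierAbs (μ : Measure ℝ) (s : ℝ) : ENNReal := ‖∫ x, ch (s * x) ∂μ‖ₑ

theorem measurable_fourierAbs (μ : Measure ℝ) [IsFiniteMeasure μ] : Measurable (fourierAbs μ) := by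
  have h : StronglyMeasurable fun z : ℝ × ℝ => ch (z.1 * z.2) :=
    (by fun_prop : Continuous fun z : ℝ × ℝ => ch (z.1 * z.2)).stronglyMeasurable
  exact h.integral_prod_right'.enorm

theorem enorm_integral_le_one {μ : Measure ℝ} [IsProbabilityMeasure μ] {f : ℝ → ℂ}
    (hf : ∀ x, ‖f x‖ ≤ 1) : ‖∫ x, f x ∂μ‖ₑ ≤ 1 := by
  have h := norm_integral_le_of_norm_le_const (μ := μ) (Filter.Eventually.of_forall hf)
  rw [← ofReal_norm]
  exact ENNReal.ofReal_le_one.2 (by simpa using h)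

theorem fourierAbs_le_one (μ : Measure ℝ) [IsProbabilityMeasure μ] (s : ℝ) :
    fourierAbs μ s ≤ 1 :=
  enorm_integral_le_one fun _ => (norm_ch _).le

theorem SimSys.fourierAbs_le {A : Type*} {μ : Measure ℝ} {r t p : A → ℝ} {ρ τ : ℝ}
    (h : SimSys μ r t p ρ τ) [IsFiniteMeasure μ] (e : Equiv.Perm A)
    (he : ∀ a, p (e a) = p a) (her : ∀ a, r (e a) = r a) (s : ℝ) :
    fourierAbs μ s ≤
      ∑' a, ENNReal.ofReal (p a) * (cosFactor t e a s * fourierAbs μ (s * r a)) := by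
  refine (h.enorm_integral_le e he (f := fun x => ch (s * x)) (by fun_prop)
    fun x => (norm_ch _).le).trans (le_of_eq (tsum_congr fun a => ?_))
  congr 1
  have h1 : ∀ x, (ch (s * (r a * x + t a)) + ch (s * (r (e a) * x + t (e a)))) / 2
      = (ch (s * t a) + ch (s * t (e a))) / 2 * ch (s * r a * x) := by
    intro x
    rw [her, mul_add, mul_add, ch_add, ch_add, ← mul_assoc]
    ring
  simp_rw [h1]
  rw [integral_const_mul, enorm_mul]
  congr 1
  rw [← ofReal_norm, norm_ch_add_div_two, cosFactor]
  congr 4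
  ring

/-! ### The Erdős–Kahane functional -/

/-- The expectation, over random words `w` of length `n`, of `(∫ (k h_w(R ·))^q dν)^θ`, where `h_w`
is the product of the factors along `w`. -/
noncomputable def ekSum {A : Type*} (r p : A → ℝ) (c : A → ℝ → ENNReal) (ν : Measure ℝ) (q : ℕ)
    (θ : ℝ) : ℕ → ℝ → (ℝ → ENNReal) → ENNReal
  | 0, _, k => (∫⁻ s, k s ^ q ∂ν) ^ θ
  | n + 1, R, k => ∑' a, ENNReal.ofReal (p a) *
      ekSum r p c ν q θ n (R * r a) (fun s => k s * c a (R * s))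

theorem lintegral_le_ekSum {A : Type*} [Countable A] {r p : A → ℝ} {c : A → ℝ → ENNReal}
    {ν : Measure ℝ} {q : ℕ} {θ : ℝ} (hν : ν univ ≤ 1) (hp : ∑' a, ENNReal.ofReal (p a) ≤ 1)
    (hc : ∀ a, Measurable (c a)) (hθ : 0 < θ) (hq : 1 ≤ q * θ) (hq1 : 1 ≤ q) {g : ℝ → ENNReal}
    (hgm : Measurable g) (hg1 : ∀ s, g s ≤ 1)
    (hg : ∀ s, g s ≤ ∑' a, ENNReal.ofReal (p a) * (c a s * g (s * r a))) (n : ℕ) :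
    ∀ (R : ℝ) (k : ℝ → ENNReal), Measurable k →
      ∫⁻ s, k s * g (R * s) ∂ν ≤ ekSum r p c ν q θ n R k ^ (1 / (q * θ)) := by
  have hq0 : (0 : ℝ) < q := by exact_mod_cast hq1
  induction n with
  | zero =>
    intro R k hk
    have h1 : (∫⁻ s, k s ^ q ∂ν) ^ (1 / (q : ℝ)) = ekSum r p c ν q θ 0 R k ^ (1 / (q * θ)) := by
      rw [ekSum, ← ENNReal.rpow_mul]
      congr 1
      field_simp
    rw [← h1]
    have h2 := lintegral_rpow_le_rpow_lintegral hν (s := 1 / (q : ℝ)) (by positivity)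
      (by rw [div_le_one hq0]; exact_mod_cast hq1) (f := fun s => k s ^ q) (by fun_prop)
    refine le_trans (lintegral_mono fun s => ?_) h2
    calc k s * g (R * s) ≤ k s * 1 := by gcongr; exact hg1 _
      _ = (k s ^ q) ^ (1 / (q : ℝ)) := by
        rw [mul_one, ← ENNReal.rpow_natCast, ← ENNReal.rpow_mul, mul_one_div_cancel hq0.ne',
          ENNReal.rpow_one]
  | succ n ih =>
    intro R k hk
    have hkm : ∀ a, Measurable fun s => k s * c a (R * s) := fun a =>
      hk.mul ((hc a).comp (measurable_const_mul R))
    calc ∫⁻ s, k s * g (R * s) ∂ν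
        ≤ ∫⁻ s, ∑' a, ENNReal.ofReal (p a) * (k s * c a (R * s) * g (R * r a * s)) ∂ν := by
          refine lintegral_mono fun s => ?_
          calc k s * g (R * s) ≤ k s * ∑' a, ENNReal.ofReal (p a) *
                (c a (R * s) * g (R * s * r a)) := by gcongr; exact hg _
            _ = _ := by
              rw [← ENNReal.tsum_mul_left]
              refine tsum_congr fun a => ?_
              rw [show R * s * r a = R * r a * s by ring]
              ring
      _ = ∑' a, ENNReal.ofReal (p a) * ∫⁻ s, k s * c a (R * s) * g (R * r a * s) ∂ν := by
          have hm : ∀ a, Measurable fun s => k s * c a (R * s) * g (R * r a * s) := fun a =>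
            (hkm a).mul (hgm.comp (measurable_const_mul _))
          rw [lintegral_tsum fun a => ((hm a).const_mul _).aemeasurable]
          exact tsum_congr fun a => lintegral_const_mul _ (hm a)
      _ ≤ ∑' a, ENNReal.ofReal (p a) *
            ekSum r p c ν q θ n (R * r a) (fun s => k s * c a (R * s)) ^ (1 / (q * θ)) := by
          gcongr with a
          exact ih _ _ (hkm a)
      _ ≤ _ := tsum_mul_rpow_le_rpow_tsum hp (by positivity)
          (by rw [div_le_one (by positivity)]; exact hq)

/-! ### Concentration at a given scale -/

/-- Every interval of length `l` has mass at most `B`. -/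
def ConcLE (m : Measure ℝ) (l : ℝ) (B : ENNReal) : Prop := ∀ x, m (Icc x (x + l)) ≤ B

theorem exists_subset_Icc {S : Set ℝ} {l : ℝ} (hS : ∀ x ∈ S, ∀ y ∈ S, |x - y| ≤ l) :
    ∃ z, S ⊆ Icc z (z + l) := by
  rcases S.eq_empty_or_nonempty with rfl | ⟨x₀, hx₀⟩
  · exact ⟨0, empty_subset _⟩
  · have hb : BddBelow S := ⟨x₀ - l, fun y hy => by
      have := (abs_le.1 (hS x₀ hx₀ y hy)).2
      linarith⟩
    refine ⟨sInf S, fun x hx => ⟨csInf_le hb hx, ?_⟩⟩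
    have : x - l ≤ sInf S := le_csInf ⟨x₀, hx₀⟩ fun y hy => by
      have := (abs_le.1 (hS x hx y hy)).2
      linarith
    linarith

theorem ConcLE.measure_le {m : Measure ℝ} {l : ℝ} {B : ENNReal} (h : ConcLE m l B) {S : Set ℝ}
    (hS : ∀ x ∈ S, ∀ y ∈ S, |x - y| ≤ l) : m S ≤ B := by
  obtain ⟨z, hz⟩ := exists_subset_Icc hS
  exact (measure_mono hz).trans (h z)

theorem ConcLE.measure_Icc_le {m : Measure ℝ} {l : ℝ} {B : ENNReal} (h : ConcLE m l B) (hl : 0 < l)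
    (x : ℝ) {L : ℝ} (hL : 0 ≤ L) : m (Icc x (x + L)) ≤ ENNReal.ofReal (L / l + 1) * B := by
  have hsub : Icc x (x + L) ⊆
      ⋃ i ∈ Finset.range (⌊L / l⌋₊ + 1), Icc (x + i * l) (x + i * l + l) := by
    intro y hy
    have h0 : 0 ≤ (y - x) / l := div_nonneg (by linarith [hy.1]) hl.le
    have h1 := Nat.floor_le h0
    have h2 := Nat.lt_floor_add_one ((y - x) / l)
    rw [le_div_iff₀ hl] at h1
    rw [div_lt_iff₀ hl] at h2
    simp only [mem_iUnion, Finset.mem_range]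
    refine ⟨⌊(y - x) / l⌋₊, ?_, by linarith, by nlinarith⟩
    refine Nat.lt_succ_of_le (Nat.floor_le_floor ?_)
    gcongr
    linarith [hy.2]
  calc m (Icc x (x + L)) ≤ ∑ i ∈ Finset.range (⌊L / l⌋₊ + 1), m (Icc (x + i * l) (x + i * l + l)) :=
        (measure_mono hsub).trans (measure_biUnion_finset_le _ _)
    _ ≤ ∑ i ∈ Finset.range (⌊L / l⌋₊ + 1), B := Finset.sum_le_sum fun i _ => h _
    _ = ENNReal.ofReal (⌊L / l⌋₊ + 1 : ℝ) * B := by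
        rw [Finset.sum_const, Finset.card_range, nsmul_eq_mul]
        congr 1
        rw [← ENNReal.ofReal_natCast]
        push_cast
        rfl
    _ ≤ _ := by
        gcongr
        exact Nat.floor_le (by positivity)

theorem ConcLE.map_mul_right {m : Measure ℝ} {l : ℝ} {B : ENNReal} (h : ConcLE m l B) {c : ℝ}
    (hc : c ≠ 0) : ConcLE (m.map (· * c)) (l * |c|) B := by
  intro x
  rw [Measure.map_apply (by fun_prop) measurableSet_Icc]
  refine h.measure_le fun y hy z hz => ?_
  have h1 : |y * c - z * c| ≤ l * |c| := by
    rw [abs_le]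
    constructor <;> linarith [hy.1, hy.2, hz.1, hz.2]
  rw [← sub_mul, abs_mul] at h1
  exact le_of_mul_le_mul_right h1 (abs_pos.2 hc)

theorem abs_cos_eq_cos_dist_round (x : ℝ) :
    |Real.cos (Real.pi * x)| = Real.cos (Real.pi * |x - round x|) := by
  have h1 : |Real.cos (Real.pi * x)| = |Real.cos (Real.pi * (x - round x))| := by
    rw [mul_sub, mul_comm Real.pi (round x : ℝ), Real.cos_sub_int_mul_pi, abs_mul]
    simp
  rw [h1, ← Real.cos_abs, abs_mul, abs_of_pos Real.pi_pos]
  refine abs_of_nonneg (Real.cos_nonneg_of_mem_Icc ?_)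
  have h2 := abs_sub_round x
  constructor <;> nlinarith [Real.pi_pos, abs_nonneg (x - round x)]

theorem abs_sub_le_of_cos_lt {d l : ℝ} (hd : d ≠ 0) (hd1 : |d| ≤ 1) (hl : 0 < l)
    (hl1 : l ≤ 1 / 2) {s s' : ℝ} (hss : |s - s'| ≤ 1 / 2)
    (hs : Real.cos (Real.pi * (|d| * l / 2)) < |Real.cos (Real.pi * (d * s))|)
    (hs' : Real.cos (Real.pi * (|d| * l / 2)) < |Real.cos (Real.pi * (d * s'))|) :
    |s - s'| ≤ l := by
  have hd0 : 0 < |d| := abs_pos.2 hd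
  have key : ∀ z, Real.cos (Real.pi * (|d| * l / 2)) < |Real.cos (Real.pi * (d * z))| →
      |d * z - round (d * z)| < |d| * l / 2 := by
    intro z hz
    rw [abs_cos_eq_cos_dist_round] at hz
    by_contra! hcon
    have h2 := abs_sub_round (d * z)
    have hle : Real.pi * |d * z - round (d * z)| ≤ Real.pi := by nlinarith [Real.pi_pos]
    have := Real.cos_le_cos_of_nonneg_of_le_pi (by positivity) hle
      (mul_le_mul_of_nonneg_left hcon Real.pi_pos.le)
    linarith
  have h1 := abs_lt.1 (key s hs)
  have h2 := abs_lt.1 (key s' hs')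
  have h3 : |d * s - d * s'| ≤ |d| * (1 / 2) := by
    rw [← mul_sub, abs_mul]
    gcongr
  have h4 : |d| * l ≤ |d| * (1 / 2) := by gcongr
  have h3' := abs_le.1 h3
  have h5 : round (d * s) = round (d * s') := by
    have h6 : |((round (d * s) - round (d * s') : ℤ) : ℝ)| < 1 := by
      push_cast
      rw [abs_lt]
      constructor <;> linarith
    have h7 : |round (d * s) - round (d * s')| < 1 := by exact_mod_cast h6
    exact sub_eq_zero.1 (Int.abs_lt_one_iff.1 h7)
  rw [h5] at h1
  have h6 : |d| * |s - s'| ≤ |d| * l := by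
    rw [← abs_mul, mul_sub, abs_le]
    constructor <;> linarith
  exact le_of_mul_le_mul_left h6 hd0

theorem ConcLE.withDensity_cos {m : Measure ℝ} {l : ℝ} {B : ENNReal} (h : ConcLE m l B)
    (hl : 0 < l) (hl1 : l ≤ 1 / 2) {d : ℝ} (hd : d ≠ 0) (hd1 : |d| ≤ 1) (q : ℕ) :
    ConcLE (m.withDensity fun s => ENNReal.ofReal |Real.cos (Real.pi * (d * s))| ^ q) (1 / 2)
      (ENNReal.ofReal (1 + Real.cos (Real.pi * (|d| * l / 2)) ^ q / l) * B) := by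
  intro x
  set b := Real.cos (Real.pi * (|d| * l / 2)) with hb
  have hb0 : 0 ≤ b := by
    refine Real.cos_nonneg_of_mem_Icc ⟨?_, ?_⟩
    · have : 0 ≤ Real.pi * (|d| * l / 2) := by positivity
      linarith [Real.pi_pos]
    · have : |d| * l ≤ 1 * (1 / 2) := by gcongr
      nlinarith [Real.pi_pos]
  set S := {s | b < |Real.cos (Real.pi * (d * s))|} with hS
  have hSm : MeasurableSet S := measurableSet_lt measurable_const (by fun_prop)
  rw [withDensity_apply _ measurableSet_Icc, ← lintegral_inter_add_sdiff _ _ hSm]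
  have h1 : ∫⁻ s in Icc x (x + 1 / 2) ∩ S, ENNReal.ofReal |Real.cos (Real.pi * (d * s))| ^ q ∂m
      ≤ B := by
    calc _ ≤ ∫⁻ s in Icc x (x + 1 / 2) ∩ S, 1 ∂m := by
          refine lintegral_mono fun s => pow_le_one₀ zero_le ?_
          exact ENNReal.ofReal_le_one.2 (Real.abs_cos_le_one _)
      _ = m (Icc x (x + 1 / 2) ∩ S) := by simp
      _ ≤ B := h.measure_le fun y hy z hz => by
          refine abs_sub_le_of_cos_lt hd hd1 hl hl1 ?_ hy.2 hz.2
          rw [abs_le]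
          constructor <;> linarith [hy.1.1, hy.1.2, hz.1.1, hz.1.2]
  have h2 : ∫⁻ s in Icc x (x + 1 / 2) \ S, ENNReal.ofReal |Real.cos (Real.pi * (d * s))| ^ q ∂m
      ≤ ENNReal.ofReal (b ^ q) * (ENNReal.ofReal (1 / l) * B) := by
    calc _ ≤ ∫⁻ s in Icc x (x + 1 / 2) \ S, ENNReal.ofReal (b ^ q) ∂m := by
          refine setLIntegral_mono measurable_const fun s hs => ?_
          rw [ENNReal.ofReal_pow hb0]
          gcongr
          exact not_lt.1 hs.2
      _ = ENNReal.ofReal (b ^ q) * m (Icc x (x + 1 / 2) \ S) := by simp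
      _ ≤ _ := by
          gcongr
          refine (measure_mono sdiff_subset).trans ((h.measure_Icc_le hl x (by norm_num)).trans ?_)
          gcongr
          rw [div_add_one hl.ne']
          gcongr
          linarith
  refine (add_le_add h1 h2).trans (le_of_eq ?_)
  rw [ENNReal.ofReal_add zero_le_one (by positivity), ENNReal.ofReal_one, add_mul, one_mul,
    ← mul_assoc, ← ENNReal.ofReal_mul (by positivity), mul_one_div]

/-! ### Moments of small order -/

namespace SimSys

variable {A : Type*} {μ : Measure ℝ} {r t p : A → ℝ} {ρ τ : ℝ}

theorem abs_pos (h : SimSys μ r t p ρ τ) (a : A) : 0 < |r a| := _root_.abs_pos.2 (h.r_ne a)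

theorem rpow_neg_le (h : SimSys μ r t p ρ τ) (hρ1 : ρ < 1) {s : ℝ} (hs : s ≤ τ) (a : A) :
    |r a| ^ (-s) ≤ |r a| ^ (-τ) :=
  Real.rpow_le_rpow_of_exponent_ge (h.abs_pos a) ((h.r_le a).trans hρ1.le) (by linarith)

theorem summable_rpow (h : SimSys μ r t p ρ τ) (hρ1 : ρ < 1) {w : A → ℝ} (hw : ∀ a, 0 ≤ w a)
    (hwp : ∀ a, w a ≤ p a) {s : ℝ} (hs : s ≤ τ) : Summable fun a => w a * |r a| ^ (-s) :=
  Summable.of_nonneg_of_le (fun a => mul_nonneg (hw a) (by positivity))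
    (fun a => mul_le_mul (hwp a) (h.rpow_neg_le hρ1 hs a) (by positivity) (h.p_pos a).le) h.moment

theorem exists_small_exponent (h : SimSys μ r t p ρ τ) (hρ1 : ρ < 1) (hτ : 0 < τ) {w : A → ℝ}
    (hw : ∀ a, 0 ≤ w a) (hwp : ∀ a, w a ≤ p a) (hw1 : ∑' a, w a < 1) :
    ∃ s₀, 0 < s₀ ∧ s₀ ≤ τ ∧ ∀ s, 0 < s → s ≤ s₀ → ∑' a, w a * |r a| ^ (-s) < 1 := by
  have h1 : Filter.Tendsto (fun s : ℝ => ∑' a, w a * |r a| ^ (-s)) (nhdsWithin 0 (Ioi 0))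
      (nhds (∑' a, w a)) := by
    refine tendsto_tsum_of_dominated_convergence h.moment (fun a => ?_) ?_
    · have : Filter.Tendsto (fun s : ℝ => w a * |r a| ^ (-s)) (nhds 0)
          (nhds (w a * |r a| ^ (-(0 : ℝ)))) :=
        ((Real.continuous_const_rpow (h.abs_pos a).ne').comp continuous_neg).tendsto 0
          |>.const_mul (w a)
      simpa using this.mono_left nhdsWithin_le_nhds
    · filter_upwards [Ioc_mem_nhdsGT hτ] with s hs a
      rw [Real.norm_of_nonneg (mul_nonneg (hw a) (by positivity))]
      exact mul_le_mul (hwp a) (h.rpow_neg_le hρ1 hs.2 a) (by positivity) (h.p_pos a).le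
  have h2 := h1.eventually (gt_mem_nhds hw1)
  obtain ⟨b, hb, hb'⟩ := mem_nhdsGT_iff_exists_Ioc_subset.1 h2
  exact ⟨min b τ, lt_min hb hτ, min_le_right _ _, fun s hs hs' =>
    hb' ⟨hs, hs'.trans (min_le_left _ _)⟩⟩

end SimSys

/-! ### The Erdős–Kahane estimate -/

theorem lyapunov_inequality {W P α δ K X Y f ε : ℝ} (hW : 0 ≤ W) (hP : 0 ≤ P) (hWP : W + P = 1)
    (hα : α < 1) (hδ : 0 < δ) (hX : 0 < X) (hδK : δ * K = ε / 4) (hε : 0 < ε)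
    (hε1 : ε ≤ 1) (hY : 0 ≤ Y)
    (hf : f ≤ 1 + ε / 4 ∨ (f ≤ 2 * Y ∧ 4 * Y ≤ (1 - α) * δ * X)) :
    W + δ * X * α + P * (f * (1 + δ * K)) ≤ (1 + ε) * (1 + δ * X) := by
  have hδX : 0 < δ * X := by positivity
  rw [hδK]
  rcases hf with hf | ⟨hf, hY'⟩
  · have h1 : f * (1 + ε / 4) ≤ (1 + ε / 4) * (1 + ε / 4) := by gcongr
    have h2 : f * (1 + ε / 4) ≤ 1 + ε := by nlinarith
    have h3 : P * (f * (1 + ε / 4)) ≤ P * (1 + ε) := by gcongr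
    have h4 : P * ε ≤ 1 * ε := by gcongr; linarith
    nlinarith
  · have h1 : f * (1 + ε / 4) ≤ 2 * Y * 2 := by
      have : f * (1 + ε / 4) ≤ 2 * Y * (1 + ε / 4) := by gcongr
      nlinarith
    have h3 : P * (f * (1 + ε / 4)) ≤ P * (2 * Y * 2) := by gcongr
    have h4 : P * (2 * Y * 2) ≤ 1 * (2 * Y * 2) := by gcongr; linarith
    nlinarith

theorem rpow_neg_le_mul_rpow {l θ M : ℝ} (hl : 0 < l) (hM : l ^ θ ≤ M) :
    l ^ (-θ) ≤ M * l ^ (-(2 * θ)) := by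
  calc l ^ (-θ) = l ^ θ * l ^ (-(2 * θ)) := by
        rw [← Real.rpow_add hl]
        congr 1
        ring
    _ ≤ _ := by gcongr

theorem one_add_div_rpow_le {l x θ : ℝ} (hl : 0 < l) (hl1 : l ≤ 1 / 2) (hx : 0 ≤ x) (hx1 : x ≤ 1)
    (hθ : 0 < θ) (hθ1 : θ ≤ 1) : (1 + x / l) ^ θ ≤ 2 * l ^ (-θ) := by
  have h1 : 1 + x / l ≤ 2 / l := by
    rw [one_add_div hl.ne']
    gcongr
    linarith
  calc (1 + x / l) ^ θ ≤ (2 / l) ^ θ := by gcongr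
    _ = 2 ^ θ * l ^ (-θ) := by
      rw [Real.div_rpow (by norm_num) hl.le, Real.rpow_neg hl.le, div_eq_mul_inv]
    _ ≤ 2 ^ (1 : ℝ) * l ^ (-θ) := by
      gcongr
      norm_num
    _ = _ := by rw [Real.rpow_one]

namespace SimSys

variable {A : Type*} {μ : Measure ℝ} {r t p : A → ℝ} {ρ τ : ℝ} {u v : A} {g : ℝ}

theorem mem_Icc_t (h : SimSys μ r t p ρ τ) (a : A) : t a ∈ Icc (0 : ℝ) 1 := by
  simpa using h.mapsTo a 0 (by simp)

theorem abs_t_sub_le (h : SimSys μ r t p ρ τ) (a b : A) : |t a - t b| ≤ 1 := by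
  have h1 := h.mem_Icc_t a
  have h2 := h.mem_Icc_t b
  rw [abs_le]
  constructor <;> linarith [h1.1, h1.2, h2.1, h2.2]

variable [DecidableEq A]

theorem tsum_ite_lt_one (h : SimSys μ r t p ρ τ) (c : ℝ) (hc : c < 1) (hc0 : 0 ≤ c) :
    ∑' a, (if a = u ∨ a = v then c * p a else p a) < 1 := by
  rw [← h.p_sum.tsum_eq]
  have h0 : ∀ a, (if a = u ∨ a = v then c * p a else p a) ≤ p a := by
    intro a
    split_ifs
    · exact mul_le_of_le_one_left (h.p_pos a).le hc.le
    · rfl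
  refine Summable.tsum_lt_tsum (i := u) h0 ?_ ?_ h.p_sum.summable
  · simpa using mul_lt_of_lt_one_left (h.p_pos u) hc
  · refine Summable.of_nonneg_of_le (fun a => ?_) h0 h.p_sum.summable
    have := (h.p_pos a).le
    split_ifs <;> positivity

theorem exists_lyapunov (h : SimSys μ r t p ρ τ) (hρ1 : ρ < 1) (htw : IsTwin r t p u v g)
    {θ : ℝ} (hθ : 0 < θ) (hθ1 : θ ≤ 1) (hθτ : 2 * θ ≤ τ)
    (hα : ∑' a, (if a = u ∨ a = v then 0 else p a) * |r a| ^ (-(2 * θ)) < 1)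
    {ε : ℝ} (hε : 0 < ε) (hε1 : ε ≤ 1) :
    ∃ δ : ℝ, 0 < δ ∧ ∃ q₀ : ℕ, ∀ q : ℕ, q₀ ≤ q → ∀ l : ℝ, 0 < l → l ≤ 1 / 2 →
      ∑' a, ENNReal.ofReal (p a) * (if a = u ∨ a = v then
        ENNReal.ofReal ((1 + Real.cos (Real.pi * (|t u - t v| * l / 2)) ^ q / l) ^ θ *
          (1 + δ * (|r u| / 2) ^ (-(2 * θ))))
        else ENNReal.ofReal (1 + δ * (l * |r a|) ^ (-(2 * θ)))) ≤
      ENNReal.ofReal ((1 + ε) * (1 + δ * l ^ (-(2 * θ)))) := by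
  set w : A → ℝ := fun a => if a = u ∨ a = v then 0 else p a with hw
  set z : A → ℝ := fun a => if a = u ∨ a = v then p a else 0 with hz
  set d := |t u - t v| with hd
  have hd0 : 0 < d := _root_.abs_pos.2 htw.sub_ne_zero
  have hd1 : d ≤ 1 := h.abs_t_sub_le u v
  have hw0 : ∀ a, 0 ≤ w a := fun a => by
    have := (h.p_pos a).le
    simp only [hw]; split_ifs <;> simp [this]
  have hz0 : ∀ a, 0 ≤ z a := fun a => by
    have := (h.p_pos a).le
    simp only [hz]; split_ifs <;> simp [this]
  have hwz : ∀ a, w a + z a = p a := fun a => by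
    simp only [hw, hz]; split_ifs <;> simp
  have hwp : ∀ a, w a ≤ p a := fun a => by linarith [hwz a, hz0 a]
  have hzp : ∀ a, z a ≤ p a := fun a => by linarith [hwz a, hw0 a]
  have hws : Summable w := .of_nonneg_of_le hw0 hwp h.p_sum.summable
  have hzs : Summable z := .of_nonneg_of_le hz0 hzp h.p_sum.summable
  have hWP : ∑' a, w a + ∑' a, z a = 1 := by
    rw [← hws.tsum_add hzs, ← h.p_sum.tsum_eq]
    exact tsum_congr hwz
  have hαs := h.summable_rpow hρ1 hw0 hwp hθτ
  set α := ∑' a, w a * |r a| ^ (-(2 * θ)) with hαdef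
  set K := (|r u| / 2) ^ (-(2 * θ)) with hK
  have hru : 0 < |r u| := h.abs_pos u
  have hK0 : 0 < K := by positivity
  have hδ : 0 < ε / 4 / K := by positivity
  set δ := ε / 4 / K with hδdef
  have hδK : δ * K = ε / 4 := div_mul_cancel₀ _ hK0.ne'
  have hα' : 0 < (1 - α) * δ / 4 := by
    have : 0 < 1 - α := by linarith
    positivity
  set l₀ := min (1 / 2) (((1 - α) * δ / 4) ^ (1 / θ)) with hl₀
  have hl₀0 : 0 < l₀ := lt_min (by norm_num) (by positivity)
  have hl₀1 : l₀ ≤ 1 / 2 := min_le_left _ _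
  set b := Real.cos (Real.pi * (d * l₀ / 2)) with hb
  have hang : d * l₀ / 2 ≤ 1 / 4 := by nlinarith
  have hang0 : 0 < d * l₀ / 2 := by positivity
  have hb1 : b < 1 := by
    rw [← Real.cos_zero]
    exact Real.cos_lt_cos_of_nonneg_of_le_pi le_rfl (by nlinarith [Real.pi_pos]) (by positivity)
  obtain ⟨q₀, hq₀⟩ := exists_pow_lt_of_lt_one (show 0 < ε / 4 * l₀ by positivity) hb1
  refine ⟨δ, hδ, q₀, fun q hq l hl hl1 => ?_⟩
  set X := l ^ (-(2 * θ)) with hX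
  set c := Real.cos (Real.pi * (d * l / 2)) with hc
  have hangl : d * l / 2 ≤ 1 / 4 := by nlinarith
  have hangl0 : 0 < d * l / 2 := by positivity
  have hc0 : 0 ≤ c :=
    Real.cos_nonneg_of_mem_Icc ⟨by nlinarith [Real.pi_pos], by nlinarith [Real.pi_pos]⟩
  have hc1 : c ≤ 1 := Real.cos_le_one _
  set f := (1 + c ^ q / l) ^ θ with hf
  have hf0 : 0 ≤ f := by positivity
  have hV : HasSum (fun a => w a + δ * X * (w a * |r a| ^ (-(2 * θ))) + z a * (f * (1 + δ * K)))
      (∑' a, w a + δ * X * α + (∑' a, z a) * (f * (1 + δ * K))) :=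
    (hws.hasSum.add (hαs.hasSum.mul_left _)).add (hzs.hasSum.mul_right _)
  have hterm : ∀ a, ENNReal.ofReal (p a) * (if a = u ∨ a = v then
        ENNReal.ofReal (f * (1 + δ * K)) else ENNReal.ofReal (1 + δ * (l * |r a|) ^ (-(2 * θ))))
      = ENNReal.ofReal
        (w a + δ * X * (w a * |r a| ^ (-(2 * θ))) + z a * (f * (1 + δ * K))) := by
    intro a
    by_cases ha : a = u ∨ a = v
    · simp only [hw, hz, if_pos ha]
      rw [← ENNReal.ofReal_mul (h.p_pos a).le]
      congr 1
      ring
    · simp only [hw, hz, if_neg ha]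
      rw [← ENNReal.ofReal_mul (h.p_pos a).le, Real.mul_rpow hl.le (abs_nonneg _)]
      congr 1
      ring
  rw [tsum_congr hterm, ← ENNReal.ofReal_tsum_of_nonneg _ hV.summable, hV.tsum_eq]
  swap
  · intro a
    have := hw0 a
    have := hz0 a
    positivity
  refine ENNReal.ofReal_le_ofReal (lyapunov_inequality (Y := l ^ (-θ)) (tsum_nonneg hw0)
    (tsum_nonneg hz0) hWP hα hδ (by positivity) hδK hε hε1 (by positivity) ?_)
  have hq1 : 1 ≤ 1 + c ^ q / l := by
    have : 0 ≤ c ^ q / l := by positivity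
    linarith
  rcases le_or_gt l₀ l with hll | hll
  · left
    have hcb : c ≤ b :=
      Real.cos_le_cos_of_nonneg_of_le_pi (by positivity) (by nlinarith [Real.pi_pos])
        (mul_le_mul_of_nonneg_left (by nlinarith) Real.pi_pos.le)
    have h1 : c ^ q ≤ ε / 4 * l₀ :=
      calc c ^ q ≤ c ^ q₀ := pow_le_pow_of_le_one hc0 hc1 hq
        _ ≤ b ^ q₀ := pow_le_pow_left₀ hc0 hcb _
        _ ≤ _ := hq₀.le
    have h2 : c ^ q / l ≤ ε / 4 := by
      rw [div_le_iff₀ hl]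
      refine h1.trans ?_
      gcongr
    calc f ≤ (1 + c ^ q / l) ^ (1 : ℝ) := Real.rpow_le_rpow_of_exponent_le hq1 hθ1
      _ ≤ _ := by rw [Real.rpow_one]; linarith
  · right
    refine ⟨one_add_div_rpow_le hl hl1 (by positivity) (pow_le_one₀ hc0 hc1) hθ hθ1, ?_⟩
    have h1 : l ^ θ ≤ (1 - α) * δ / 4 :=
      calc l ^ θ ≤ (((1 - α) * δ / 4) ^ (1 / θ)) ^ θ :=
            Real.rpow_le_rpow hl.le (hll.le.trans (min_le_right _ _)) hθ.le
        _ = _ := by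
          rw [← Real.rpow_mul hα'.le, one_div_mul_cancel hθ.ne', Real.rpow_one]
    have h2 := rpow_neg_le_mul_rpow hl h1
    calc 4 * l ^ (-θ) ≤ 4 * ((1 - α) * δ / 4 * X) := mul_le_mul_of_nonneg_left h2 (by norm_num)
      _ = _ := by ring

end SimSys

/-- The measure `k^q ν`, dilated by `R`. -/
noncomputable def dilated (ν : Measure ℝ) (q : ℕ) (R : ℝ) (k : ℝ → ENNReal) : Measure ℝ :=
  (ν.withDensity fun s => k s ^ q).map fun s => R * s

theorem dilated_mul {ν : Measure ℝ} {q : ℕ} {R r : ℝ} {k c : ℝ → ENNReal} (hk : Measurable k)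
    (hc : Measurable c) :
    dilated ν q (R * r) (fun s => k s * c (R * s)) =
      ((dilated ν q R k).withDensity fun s => c s ^ q).map (· * r) := by
  ext S hS
  have hR : Measurable fun s : ℝ => R * s := measurable_const_mul R
  have hS' : MeasurableSet ((fun s : ℝ => s * r) ⁻¹' S) := (measurable_mul_const r) hS
  rw [dilated, Measure.map_apply (by fun_prop) hS, Measure.map_apply (by fun_prop) hS,
    withDensity_apply _ hS', dilated, setLIntegral_map hS' (by fun_prop) hR,
    setLIntegral_withDensity_eq_setLIntegral_mul _ (by fun_prop) (by fun_prop) (hR hS'),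
    withDensity_apply _ (measurable_const_mul _ hS)]
  have hset : (fun s => R * r * s) ⁻¹' S = (fun s => R * s) ⁻¹' ((fun s : ℝ => s * r) ⁻¹' S) := by
    ext s
    simp only [mem_preimage]
    rw [show R * r * s = R * s * r by ring]
  rw [hset]
  refine lintegral_congr fun s => ?_
  simp [mul_pow]

theorem dilated_univ (ν : Measure ℝ) (q : ℕ) (R : ℝ) (k : ℝ → ENNReal) :
    dilated ν q R k univ = ∫⁻ s, k s ^ q ∂ν := by
  rw [dilated, Measure.map_apply (by fun_prop) MeasurableSet.univ, preimage_univ,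
    withDensity_apply _ MeasurableSet.univ, Measure.restrict_univ]

namespace SimSys

variable {A : Type*} {μ : Measure ℝ} {r t p : A → ℝ} {ρ τ : ℝ} {u v : A} {g : ℝ}

theorem ekSum_le [DecidableEq A] (h : SimSys μ r t p ρ τ) (hρ : 0 < ρ) (hρ1 : ρ < 1)
    (htw : IsTwin r t p u v g) {θ ε δ : ℝ} (hθ : 0 < θ) (hθ1 : θ ≤ 1) (hε : 0 < ε) (hδ : 0 < δ)
    {q : ℕ} (hlyap : ∀ l : ℝ, 0 < l → l ≤ 1 / 2 →
      ∑' a, ENNReal.ofReal (p a) * (if a = u ∨ a = v then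
        ENNReal.ofReal ((1 + Real.cos (Real.pi * (|t u - t v| * l / 2)) ^ q / l) ^ θ *
          (1 + δ * (|r u| / 2) ^ (-(2 * θ))))
        else ENNReal.ofReal (1 + δ * (l * |r a|) ^ (-(2 * θ)))) ≤
      ENNReal.ofReal ((1 + ε) * (1 + δ * l ^ (-(2 * θ)))))
    {ν : Measure ℝ} (n : ℕ) : ∀ (R : ℝ) (k : ℝ → ENNReal) (l : ℝ) (B : ENNReal), Measurable k →
      0 < l → l ≤ 1 / 2 → (∀ᵐ s ∂dilated ν q R k, ρ ^ n * |s| ≤ 1) →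
      ConcLE (dilated ν q R k) l B →
      ekSum r p (cosFactor t (Equiv.swap u v)) ν q θ n R k ≤
        ENNReal.ofReal (3 / δ * (1 + ε) ^ n * (1 + δ * l ^ (-(2 * θ)))) * B ^ θ := by
  induction n with
  | zero =>
    intro R k l B hk hl hl1 hsupp hB
    have h1 : dilated ν q R k univ ≤ ENNReal.ofReal (3 / l) * B := by
      calc dilated ν q R k univ ≤ dilated ν q R k (Icc (-1) (-1 + 2)) := by
            refine measure_mono_ae ?_
            filter_upwards [hsupp] with s hs _
            rw [pow_zero, one_mul, abs_le] at hs
            exact ⟨hs.1, by linarith [hs.2]⟩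
        _ ≤ _ := hB.measure_Icc_le hl _ (by norm_num)
        _ ≤ _ := by
            gcongr
            rw [div_add_one hl.ne']
            gcongr
            linarith
    rw [ekSum, ← dilated_univ ν q R k]
    calc _ ≤ (ENNReal.ofReal (3 / l) * B) ^ θ := by gcongr
      _ = ENNReal.ofReal ((3 / l) ^ θ) * B ^ θ := by
        rw [ENNReal.mul_rpow_of_nonneg _ _ hθ.le,
          ENNReal.ofReal_rpow_of_nonneg (by positivity) hθ.le]
      _ ≤ _ := by
        gcongr
        rw [pow_zero, mul_one, mul_add, ← mul_assoc, div_mul_cancel₀ _ hδ.ne']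
        have h2 : (3 / l) ^ θ ≤ 3 * l ^ (-(2 * θ)) := by
          rw [Real.div_rpow (by norm_num) hl.le, div_eq_mul_inv, ← Real.rpow_neg hl.le]
          have h3 : (3 : ℝ) ^ θ ≤ 3 ^ (1 : ℝ) := by
            gcongr
            norm_num
          rw [Real.rpow_one] at h3
          have h4 : l ^ (-θ) ≤ l ^ (-(2 * θ)) :=
            Real.rpow_le_rpow_of_exponent_ge hl (by linarith) (by linarith)
          gcongr
        have : 0 < 3 / δ * 1 := by positivity
        linarith
  | succ n ih =>
    intro R k l B hk hl hl1 hsupp hB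
    have hcm := measurable_cosFactor t (Equiv.swap u v)
    rw [ekSum]
    have hstep : ∀ a, ekSum r p (cosFactor t (Equiv.swap u v)) ν q θ n (R * r a)
          (fun s => k s * cosFactor t (Equiv.swap u v) a (R * s)) ≤
        ENNReal.ofReal (3 / δ * (1 + ε) ^ n) * B ^ θ * (if a = u ∨ a = v then
        ENNReal.ofReal ((1 + Real.cos (Real.pi * (|t u - t v| * l / 2)) ^ q / l) ^ θ *
          (1 + δ * (|r u| / 2) ^ (-(2 * θ))))
        else ENNReal.ofReal (1 + δ * (l * |r a|) ^ (-(2 * θ)))) := by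
      intro a
      have hra := h.abs_pos a
      have hra1 : |r a| < 1 := (h.r_le a).trans_lt hρ1
      have hkm : Measurable fun s => k s * cosFactor t (Equiv.swap u v) a (R * s) :=
        hk.mul ((hcm a).comp (measurable_const_mul R))
      have hs' : ∀ᵐ s ∂dilated ν q (R * r a)
          (fun s => k s * cosFactor t (Equiv.swap u v) a (R * s)), ρ ^ n * |s| ≤ 1 := by
        rw [dilated_mul hk (hcm a), ae_map_iff (by fun_prop)
          (measurableSet_le (by fun_prop) measurable_const)]
        refine (withDensity_absolutelyContinuous _ _).ae_le ?_
        filter_upwards [hsupp] with s hs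
        rw [abs_mul]
        calc ρ ^ n * (|s| * |r a|) ≤ ρ ^ n * (|s| * ρ) := by
              gcongr
              exact h.r_le a
          _ = ρ ^ (n + 1) * |s| := by ring
          _ ≤ 1 := hs
      by_cases ha : a = u ∨ a = v
      · rw [if_pos ha]
        have hcos : cosFactor t (Equiv.swap u v) a =
            fun s => ENNReal.ofReal |Real.cos (Real.pi * ((t u - t v) * s))| := by
          funext s
          rcases ha with rfl | rfl
          · rw [cosFactor, Equiv.swap_apply_left]
          · rw [cosFactor, Equiv.swap_apply_right, ← Real.cos_neg]
            congr 3
            ring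
        have hrau : |r a| = |r u| := by
          rcases ha with rfl | rfl
          · rfl
          · rw [htw.r_eq]
        have hang : |t u - t v| * l / 2 ≤ 1 / 2 := by
          have := h.abs_t_sub_le u v
          have := abs_nonneg (t u - t v)
          nlinarith
        have hcos0 : 0 ≤ Real.cos (Real.pi * (|t u - t v| * l / 2)) :=
          Real.cos_nonneg_of_mem_Icc
            ⟨by have : 0 ≤ Real.pi * (|t u - t v| * l / 2) := by positivity
                linarith [Real.pi_pos], by nlinarith [Real.pi_pos]⟩
        have hconc := (hB.withDensity_cos hl hl1 htw.sub_ne_zero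
          (h.abs_t_sub_le u v) q).map_mul_right (h.r_ne a)
        have hd := dilated_mul (ν := ν) (q := q) (R := R) (r := r a) hk (hcm a)
        simp only [hcos] at hd ⊢
        rw [← hd, hrau] at hconc
        simp only [hcos] at hs' hkm
        refine (ih _ _ _ _ hkm (by rw [hrau] at hra; positivity) (by rw [hrau] at hra1; linarith)
          hs' hconc).trans (le_of_eq ?_)
        rw [ENNReal.mul_rpow_of_nonneg _ _ hθ.le,
          ENNReal.ofReal_rpow_of_nonneg (by positivity) hθ.le, ENNReal.ofReal_mul (by positivity),
          ENNReal.ofReal_mul (p := _ ^ θ) (by positivity),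
          show 1 / 2 * |r u| = |r u| / 2 by ring]
        ring
      · rw [if_neg ha]
        have ha' := not_or.1 ha
        have hcos : cosFactor t (Equiv.swap u v) a = fun _ => 1 := by
          funext s
          rw [cosFactor, Equiv.swap_apply_of_ne_of_ne ha'.1 ha'.2]
          simp
        have hconc := hB.map_mul_right (h.r_ne a)
        have hd := dilated_mul (ν := ν) (q := q) (R := R) (r := r a) hk (hcm a)
        simp only [hcos, one_pow] at hd ⊢
        rw [show (fun _ : ℝ => (1 : ENNReal)) = 1 from rfl, withDensity_one] at hd
        rw [← hd] at hconc
        simp only [hcos] at hs' hkm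
        refine (ih _ _ _ _ hkm (by positivity) (by nlinarith) hs' hconc).trans (le_of_eq ?_)
        rw [ENNReal.ofReal_mul (by positivity)]
        ring
    calc _ ≤ ∑' a, ENNReal.ofReal (p a) * (ENNReal.ofReal (3 / δ * (1 + ε) ^ n) * B ^ θ *
          (if a = u ∨ a = v then
        ENNReal.ofReal ((1 + Real.cos (Real.pi * (|t u - t v| * l / 2)) ^ q / l) ^ θ *
          (1 + δ * (|r u| / 2) ^ (-(2 * θ))))
        else ENNReal.ofReal (1 + δ * (l * |r a|) ^ (-(2 * θ))))) := by
          gcongr with a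
          exact hstep a
      _ = ENNReal.ofReal (3 / δ * (1 + ε) ^ n) * B ^ θ * ∑' a, ENNReal.ofReal (p a) *
          (if a = u ∨ a = v then
        ENNReal.ofReal ((1 + Real.cos (Real.pi * (|t u - t v| * l / 2)) ^ q / l) ^ θ *
          (1 + δ * (|r u| / 2) ^ (-(2 * θ))))
        else ENNReal.ofReal (1 + δ * (l * |r a|) ^ (-(2 * θ)))) := by
          rw [← ENNReal.tsum_mul_left]
          exact tsum_congr fun a => by ring
      _ ≤ ENNReal.ofReal (3 / δ * (1 + ε) ^ n) * B ^ θ *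
          ENNReal.ofReal ((1 + ε) * (1 + δ * l ^ (-(2 * θ)))) := by
          gcongr
          exact hlyap l hl hl1
      _ = _ := by
          rw [mul_right_comm, ← ENNReal.ofReal_mul (by positivity)]
          congr 2
          ring

theorem exists_lintegral_fourierAbs_le [Countable A] [IsProbabilityMeasure μ]
    (h : SimSys μ r t p ρ τ) (hρ : 0 < ρ) (hρ1 : ρ < 1) (hτ : 0 < τ)
    (htw : IsTwin r t p u v g) {γ : ℝ} (hγ : 0 < γ) (q₁ : ℕ) :
    ∃ q : ℕ, q₁ ≤ q ∧ ∃ C : ℝ, 0 < C ∧ ∀ (ν : Measure ℝ) (n : ℕ) (l : ℝ) (B : ENNReal),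
      ν univ ≤ 1 → 0 < l → l ≤ 1 / 2 → (∀ᵐ s ∂ν, ρ ^ n * |s| ≤ 1) → ConcLE ν l B →
      ∫⁻ s, fourierAbs μ s ∂ν ≤
        ENNReal.ofReal (C * (ρ ^ n) ^ (-(γ / q)) * l ^ (-(2 / q : ℝ))) * B ^ (1 / q : ℝ) := by
  classical
  obtain ⟨s₀, hs₀, hs₀τ, hs₀'⟩ := h.exists_small_exponent hρ1 hτ
    (w := fun a => if a = u ∨ a = v then 0 else p a)
    (fun a => by have := (h.p_pos a).le; split_ifs <;> simp [this])
    (fun a => by have := (h.p_pos a).le; split_ifs <;> simp [this])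
    (by simpa using h.tsum_ite_lt_one (u := u) (v := v) 0 one_pos le_rfl)
  set θ := min 1 (s₀ / 2) with hθdef
  have hθ : 0 < θ := lt_min one_pos (by positivity)
  have hθ1 : θ ≤ 1 := min_le_left _ _
  have hθ2 : 2 * θ ≤ s₀ := by
    have : θ ≤ s₀ / 2 := min_le_right _ _
    linarith
  have hρθ : 1 < ρ ^ (-(γ * θ)) :=
    Real.one_lt_rpow_of_pos_of_lt_one_of_neg hρ hρ1 (by have := mul_pos hγ hθ; linarith)
  set ε := min 1 (ρ ^ (-(γ * θ)) - 1) with hεdef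
  have hε : 0 < ε := lt_min one_pos (by linarith)
  have hεle : 1 + ε ≤ ρ ^ (-(γ * θ)) := by
    have : ε ≤ ρ ^ (-(γ * θ)) - 1 := min_le_right _ _
    linarith
  obtain ⟨δ, hδ, q₀, hq₀⟩ := h.exists_lyapunov hρ1 htw hθ hθ1 (hθ2.trans hs₀τ)
    (hs₀' _ (by positivity) hθ2) hε (min_le_left _ _)
  obtain ⟨q₂, hq₂⟩ := exists_nat_ge (1 / θ)
  set q := max (max q₀ q₁) (max q₂ 1) with hq
  have hqq₂ : q₂ ≤ q := (le_max_left _ _).trans (le_max_right _ _)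
  have hq1 : 1 ≤ q := (le_max_right _ _).trans (le_max_right _ _)
  have hqθ : 1 ≤ q * θ := by
    rw [div_le_iff₀ hθ] at hq₂
    have : (q₂ : ℝ) ≤ q := by exact_mod_cast hqq₂
    nlinarith
  have hq0 : (0 : ℝ) < q := by exact_mod_cast hq1
  refine ⟨q, (le_max_right _ _).trans (le_max_left _ _), (3 / δ * (1 + δ)) ^ (1 / (q * θ)),
    by positivity, fun ν n l B hν hl hl1 hsupp hB => ?_⟩
  have hdil : dilated ν q 1 (fun _ => 1) = ν := by
    simp only [dilated, one_pow, one_mul]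
    rw [show (fun _ : ℝ => (1 : ENNReal)) = 1 from rfl, withDensity_one]
    exact Measure.map_id
  have h1 := lintegral_le_ekSum hν h.tsum_p.le (measurable_cosFactor t (Equiv.swap u v)) hθ hqθ hq1
    (measurable_fourierAbs μ) (fourierAbs_le_one μ)
    (h.fourierAbs_le (Equiv.swap u v)
      (Equiv.apply_swap_eq_self htw.p_eq) (Equiv.apply_swap_eq_self htw.r_eq)) n 1 (fun _ => 1)
    measurable_const
  have h2 := h.ekSum_le hρ hρ1 htw hθ hθ1 hε hδ (hq₀ q ((le_max_left _ _).trans (le_max_left _ _)))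
    (ν := ν) n 1 (fun _ => 1) l B measurable_const hl hl1 (by rwa [hdil]) (by rwa [hdil])
  simp only [one_mul] at h1
  have hl2 : 1 ≤ l ^ (-(2 * θ)) :=
    Real.one_le_rpow_of_pos_of_le_one_of_nonpos hl (by linarith) (by linarith)
  have h3 : 3 / δ * (1 + ε) ^ n * (1 + δ * l ^ (-(2 * θ))) ≤
      3 / δ * (1 + δ) * (ρ ^ n) ^ (-(γ * θ)) * l ^ (-(2 * θ)) := by
    have h4 : (1 + ε) ^ n ≤ (ρ ^ n) ^ (-(γ * θ)) := by
      calc (1 + ε) ^ n ≤ (ρ ^ (-(γ * θ))) ^ n := by gcongr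
        _ = _ := by
          rw [← Real.rpow_natCast, ← Real.rpow_mul hρ.le, ← Real.rpow_natCast,
            ← Real.rpow_mul hρ.le, mul_comm]
    have h5 : 1 + δ * l ^ (-(2 * θ)) ≤ (1 + δ) * l ^ (-(2 * θ)) := by linarith
    calc _ ≤ 3 / δ * (ρ ^ n) ^ (-(γ * θ)) * ((1 + δ) * l ^ (-(2 * θ))) := by gcongr
      _ = _ := by ring
  calc ∫⁻ s, fourierAbs μ s ∂ν
      ≤ (ENNReal.ofReal (3 / δ * (1 + δ) * (ρ ^ n) ^ (-(γ * θ)) * l ^ (-(2 * θ))) * B ^ θ)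
          ^ (1 / (q * θ)) := by
        refine h1.trans ?_
        gcongr
        refine h2.trans ?_
        gcongr
    _ = _ := by
        have e1 : (ρ ^ n) ^ (-(γ * θ) * (1 / (q * θ))) = (ρ ^ n) ^ (-(γ / q)) := by
          congr 1
          field_simp
        have e2 : l ^ (-(2 * θ) * (1 / (q * θ))) = l ^ (-(2 / q : ℝ)) := by
          congr 1
          field_simp
        have e3 : B ^ (θ * (1 / (q * θ))) = B ^ (1 / q : ℝ) := by
          congr 1
          field_simp
        rw [ENNReal.mul_rpow_of_nonneg _ _ (by positivity),
          ENNReal.ofReal_rpow_of_nonneg (by positivity) (by positivity), ← ENNReal.rpow_mul,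
          Real.mul_rpow (by positivity) (by positivity),
          Real.mul_rpow (by positivity) (by positivity), ← Real.rpow_mul (by positivity),
          ← Real.rpow_mul hl.le, e1, e2, e3]

end SimSys

/-! ### Random words stopped at a given scale -/

/-- Words over the alphabet carry the discrete `σ`-algebra. -/
@[reducible] def listMeasurableSpace (A : Type*) : MeasurableSpace (List A) := ⊤

attribute [local instance] listMeasurableSpace

/-- The contraction ratio of a word. -/
def wordRatio {A : Type*} (r : A → ℝ) : List A → ℝ
  | [] => 1
  | a :: w => r a * wordRatio r w

/-- The uniform distribution of the images of `0` under the words obtained from a given one by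
replacing any of its letters `a` with `e a`. -/
noncomputable def wordMeas {A : Type*} (r t : A → ℝ) (e : Equiv.Perm A) : List A → Measure ℝ
  | [] => Measure.dirac 0
  | a :: w => (2⁻¹ : ENNReal) • ((wordMeas r t e w).map (fun x => r a * x + t a) +
      (wordMeas r t e w).map (fun x => r (e a) * x + t (e a)))

/-- The law of a random word, stopped when its ratio is at most `x`, or at length `n`. -/
noncomputable def stopMeas {A : Type*} (r p : A → ℝ) : ℕ → ℝ → Measure (List A)
  | 0, _ => Measure.dirac []
  | n + 1, x => if 1 ≤ x then Measure.dirac [] else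
      Measure.sum fun a => ENNReal.ofReal (p a) • (stopMeas r p n (x / |r a|)).map (List.cons a)

section

variable {A : Type*} {r t p : A → ℝ} {e : Equiv.Perm A}

instance isProbabilityMeasure_wordMeas (w : List A) :
    IsProbabilityMeasure (wordMeas r t e w) := by
  induction w with
  | nil => rw [wordMeas]; infer_instance
  | cons a w ih =>
    constructor
    rw [wordMeas, Measure.smul_apply, Measure.add_apply,
      Measure.map_apply (by fun_prop) MeasurableSet.univ,
      Measure.map_apply (by fun_prop) MeasurableSet.univ, preimage_univ, preimage_univ,
      measure_univ, smul_eq_mul, one_add_one_eq_two, ENNReal.inv_mul_cancel] <;> simp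

theorem lintegral_stopMeas_succ (n : ℕ) {x : ℝ} (hx : x < 1) (f : List A → ENNReal) :
    ∫⁻ w, f w ∂stopMeas r p (n + 1) x =
      ∑' a, ENNReal.ofReal (p a) * ∫⁻ w, f (a :: w) ∂stopMeas r p n (x / |r a|) := by
  rw [stopMeas, if_neg (not_le.2 hx), lintegral_sum_measure]
  refine tsum_congr fun a => ?_
  rw [lintegral_smul_measure, smul_eq_mul, lintegral_map measurable_from_top measurable_from_top]

theorem lintegral_stopMeas_of_le (n : ℕ) {x : ℝ} (hx : n = 0 ∨ 1 ≤ x) (f : List A → ENNReal) :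
    ∫⁻ w, f w ∂stopMeas r p n x = f [] := by
  have h : stopMeas r p n x = Measure.dirac [] := by
    cases n with
    | zero => rfl
    | succ n => rw [stopMeas, if_pos (hx.resolve_left (by simp))]
  rw [h, lintegral_dirac' _ measurable_from_top]

theorem integral_wordMeas_cons (a : A) (w : List A) {f : ℝ → ℂ} (hf : StronglyMeasurable f)
    {c : ℝ} (hfc : ∀ x, ‖f x‖ ≤ c) :
    ∫ x, f x ∂wordMeas r t e (a :: w) =
      ∫ x, (f (r a * x + t a) + f (r (e a) * x + t (e a))) / 2 ∂wordMeas r t e w := by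
  have hi : ∀ (m : Measure ℝ) [IsProbabilityMeasure m] (φ : ℝ → ℝ), Measurable φ →
      Integrable (fun x => f (φ x)) m := fun m _ φ hφ =>
    Integrable.of_bound (hf.comp_measurable hφ).aestronglyMeasurable c
      (Filter.Eventually.of_forall fun x => hfc _)
  have hi' : ∀ (φ : ℝ → ℝ), Measurable φ → Integrable f ((wordMeas r t e w).map φ) :=
    fun φ hφ => (integrable_map_measure hf.aestronglyMeasurable hφ.aemeasurable).2 (hi _ φ hφ)
  rw [wordMeas, integral_smul_measure, integral_add_measure (hi' _ (by fun_prop))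
    (hi' _ (by fun_prop)), integral_map (by fun_prop) hf.aestronglyMeasurable,
    integral_map (by fun_prop) hf.aestronglyMeasurable, integral_div,
    integral_add (hi _ _ (by fun_prop)) (hi _ _ (by fun_prop))]
  simp only [ENNReal.toReal_inv, ENNReal.toReal_ofNat, Complex.real_smul]
  push_cast
  ring

end

namespace SimSys

variable {A : Type*} {μ : Measure ℝ} {r t p : A → ℝ} {ρ τ : ℝ} {u v : A} {g : ℝ}

theorem isProbabilityMeasure_stopMeas (h : SimSys μ r t p ρ τ) (n : ℕ) (x : ℝ) :
    IsProbabilityMeasure (stopMeas r p n x) := by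
  constructor
  rw [← lintegral_one]
  induction n generalizing x with
  | zero => rw [lintegral_stopMeas_of_le 0 (.inl rfl)]
  | succ n ih =>
    rcases le_or_gt 1 x with hx | hx
    · rw [lintegral_stopMeas_of_le _ (.inr hx)]
    · rw [lintegral_stopMeas_succ n hx]
      simp_rw [ih, mul_one]
      exact h.tsum_p

theorem lt_div (h : SimSys μ r t p ρ τ) {x y : ℝ} (hx : ρ * y ≤ x) (hy : 0 ≤ y) (a : A) :
    y ≤ x / |r a| := by
  rw [le_div_iff₀ (h.abs_pos a)]
  calc y * |r a| ≤ y * ρ := by gcongr; exact h.r_le a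
    _ ≤ x := by linarith

theorem ae_abs_wordRatio_le [Countable A] (h : SimSys μ r t p ρ τ) (hρ : 0 < ρ) (n : ℕ) {x : ℝ}
    (hx : ρ ^ n ≤ x) : ∀ᵐ w ∂stopMeas r p n x, |wordRatio r w| ≤ x := by
  induction n generalizing x with
  | zero =>
    rw [stopMeas, ae_dirac_iff MeasurableSpace.measurableSet_top]
    simpa [wordRatio] using hx
  | succ n ih =>
    rw [stopMeas]
    split_ifs with hx1
    · rw [ae_dirac_iff MeasurableSpace.measurableSet_top]
      simpa [wordRatio] using hx1
    · rw [Measure.ae_sum_iff]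
      intro a
      refine Measure.ae_smul_measure ?_ _
      rw [ae_map_iff measurable_from_top.aemeasurable
        MeasurableSpace.measurableSet_top]
      filter_upwards [ih (h.lt_div (by rwa [← pow_succ']) (by positivity) a)] with w hw
      rw [le_div_iff₀ (h.abs_pos a)] at hw
      rw [wordRatio, abs_mul]
      linarith

theorem enorm_integral_le_lintegral_stopMeas (h : SimSys μ r t p ρ τ) [IsProbabilityMeasure μ]
    (e : Equiv.Perm A) (he : ∀ a, p (e a) = p a) (her : ∀ a, r (e a) = r a) (n : ℕ) (x : ℝ)
    {f : ℝ → ℂ} (hf : Continuous f) (hf1 : ∀ x, ‖f x‖ ≤ 1) :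
    ‖∫ y, f y ∂μ‖ₑ ≤ ∫⁻ w, ‖∫ z, ∫ y, f (z + wordRatio r w * y) ∂μ ∂wordMeas r t e w‖ₑ
      ∂stopMeas r p n x := by
  have hbase : ∀ {f : ℝ → ℂ}, ‖∫ y, f y ∂μ‖ₑ =
      ‖∫ z, ∫ y, f (z + wordRatio r [] * y) ∂μ ∂wordMeas r t e []‖ₑ := by
    intro f
    rw [wordMeas, integral_dirac]
    simp [wordRatio]
  induction n generalizing x f with
  | zero =>
    rw [lintegral_stopMeas_of_le 0 (.inl rfl)]
    exact hbase.le
  | succ n ih =>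
    rcases le_or_gt 1 x with hx | hx
    · rw [lintegral_stopMeas_of_le _ (.inr hx)]
      exact hbase.le
    · rw [lintegral_stopMeas_succ n hx]
      refine (h.enorm_integral_le e he hf hf1).trans ?_
      gcongr with a
      refine (ih (x / |r a|) (f := fun x => (f (r a * x + t a) + f (r (e a) * x + t (e a))) / 2)
        (by fun_prop) fun x => ?_).trans (lintegral_mono fun w => le_of_eq ?_)
      · rw [norm_div, Complex.norm_ofNat, div_le_one (by norm_num)]
        exact (norm_add_le _ _).trans (by
          linarith [hf1 (r a * x + t a), hf1 (r (e a) * x + t (e a))])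
      · have hsm : StronglyMeasurable fun z => ∫ y, f (z + wordRatio r (a :: w) * y) ∂μ :=
          (by fun_prop : Continuous fun q : ℝ × ℝ => f (q.1 + wordRatio r (a :: w) * q.2)
            ).stronglyMeasurable.integral_prod_right'
        rw [integral_wordMeas_cons a w hsm (c := 1) fun x => by
          simpa using norm_integral_le_of_norm_le_const (μ := μ)
            (Filter.Eventually.of_forall fun y => hf1 (x + wordRatio r (a :: w) * y))]
        congr 1
        refine integral_congr_ae (Filter.Eventually.of_forall fun z => ?_)
        have hi : ∀ b : ℝ, Integrable (fun y => f (b + wordRatio r (a :: w) * y)) μ := fun b =>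
          Integrable.of_bound (by fun_prop) 1 (Filter.Eventually.of_forall fun x => hf1 _)
        simp only
        rw [← integral_add (hi _) (hi _), ← integral_div]
        refine integral_congr_ae (Filter.Eventually.of_forall fun y => ?_)
        simp only [wordRatio, her]
        ring_nf

/-- The moments of the overshoot. -/
theorem lintegral_overshoot_le (h : SimSys μ r t p ρ τ) (hρ : 0 < ρ) (hρ1 : ρ < 1) (hτ : 0 < τ)
    {β : ℝ} (hβ : 0 < β) :
    ∃ K : ℝ, 0 ≤ K ∧ ∀ (n : ℕ) (x : ℝ), 0 < x →
      ∫⁻ w, ENNReal.ofReal ((x / |wordRatio r w|) ^ τ) ∂stopMeas r p n x ≤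
        ENNReal.ofReal (x ^ τ + K * x ^ (-β)) := by
  set Z := ∑' a, p a * |r a| ^ (-τ) with hZ
  have hZ0 : 0 ≤ Z := tsum_nonneg fun a => mul_nonneg (h.p_pos a).le (by positivity)
  have hρβ : ρ ^ β < 1 := Real.rpow_lt_one hρ.le hρ1 hβ
  have hK : 0 ≤ Z / (1 - ρ ^ β) := div_nonneg hZ0 (by linarith)
  refine ⟨Z / (1 - ρ ^ β), hK, ?_⟩
  set K := Z / (1 - ρ ^ β) with hKdef
  have hKZ : K * (1 - ρ ^ β) = Z := div_mul_cancel₀ _ (by linarith)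
  intro n
  have hbase : ∀ x : ℝ, 0 < x → ENNReal.ofReal ((x / |wordRatio r ([] : List A)|) ^ τ) ≤
      ENNReal.ofReal (x ^ τ + K * x ^ (-β)) := by
    intro x hx
    refine ENNReal.ofReal_le_ofReal ?_
    rw [wordRatio, abs_one, div_one]
    have : 0 ≤ K * x ^ (-β) := by positivity
    linarith
  induction n with
  | zero =>
    intro x hx
    rw [lintegral_stopMeas_of_le 0 (.inl rfl)]
    exact hbase x hx
  | succ n ih =>
    intro x hx
    rcases le_or_gt 1 x with hx1 | hx1
    · rw [lintegral_stopMeas_of_le _ (.inr hx1)]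
      exact hbase x hx
    · rw [lintegral_stopMeas_succ n hx1]
      have hterm : ∀ a, ENNReal.ofReal (p a) *
          ∫⁻ w, ENNReal.ofReal ((x / |wordRatio r (a :: w)|) ^ τ) ∂stopMeas r p n (x / |r a|) ≤
          ENNReal.ofReal (x ^ τ * (p a * |r a| ^ (-τ)) + K * x ^ (-β) * ρ ^ β * p a) := by
        intro a
        have hra := h.abs_pos a
        have hpa := h.p_pos a
        have h1 := ih (x / |r a|) (by positivity)
        simp only [wordRatio, abs_mul, div_mul_eq_div_div] at h1 ⊢
        calc _ ≤ ENNReal.ofReal (p a) *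
              ENNReal.ofReal ((x / |r a|) ^ τ + K * (x / |r a|) ^ (-β)) := by gcongr
          _ ≤ _ := by
            rw [← ENNReal.ofReal_mul hpa.le]
            refine ENNReal.ofReal_le_ofReal ?_
            rw [Real.div_rpow hx.le hra.le, Real.div_rpow hx.le hra.le, Real.rpow_neg hra.le β,
              Real.rpow_neg hra.le τ, div_inv_eq_mul]
            have h2 : |r a| ^ β ≤ ρ ^ β := by gcongr; exact h.r_le a
            have h3 : K * x ^ (-β) * |r a| ^ β * p a ≤ K * x ^ (-β) * ρ ^ β * p a := by gcongr
            calc _ = x ^ τ * (p a * (|r a| ^ τ)⁻¹) + K * x ^ (-β) * |r a| ^ β * p a := by ring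
              _ ≤ _ := by linarith
      refine (ENNReal.tsum_le_tsum hterm).trans ?_
      have hsum := (h.moment.hasSum.mul_left (x ^ τ)).add (h.p_sum.mul_left (K * x ^ (-β) * ρ ^ β))
      rw [← ENNReal.ofReal_tsum_of_nonneg _ hsum.summable, hsum.tsum_eq]
      · refine ENNReal.ofReal_le_ofReal ?_
        rw [← hZ, mul_one]
        have h1 : x ^ τ ≤ 1 := Real.rpow_le_one hx.le hx1.le hτ.le
        have h2 : 1 ≤ x ^ (-β) :=
          Real.one_le_rpow_of_pos_of_le_one_of_nonpos hx hx1.le (by linarith)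
        have h3 : x ^ τ * Z ≤ x ^ (-β) * Z := mul_le_mul_of_nonneg_right (h1.trans h2) hZ0
        have h4 : K * x ^ (-β) * ρ ^ β + x ^ (-β) * Z = K * x ^ (-β) := by
          rw [← hKZ]
          ring
        have h5 : 0 ≤ x ^ τ := by positivity
        linarith
      · intro a
        have := h.p_pos a
        positivity

theorem ae_wordMeas (h : SimSys μ r t p ρ τ) (e : Equiv.Perm A) (her : ∀ a, r (e a) = r a)
    (w : List A) : ∀ᵐ x ∂wordMeas r t e w,
      x ∈ Icc (0 : ℝ) 1 ∧ x + wordRatio r w ∈ Icc (0 : ℝ) 1 := by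
  induction w with
  | nil =>
    rw [wordMeas, ae_dirac_iff (by measurability)]
    simp [wordRatio]
  | cons a w ih =>
    rw [wordMeas]
    refine Measure.ae_smul_measure ?_ _
    have key : ∀ b, r b = r a → ∀ᵐ x ∂(wordMeas r t e w).map (fun x => r b * x + t b),
        x ∈ Icc (0 : ℝ) 1 ∧ x + wordRatio r (a :: w) ∈ Icc (0 : ℝ) 1 := by
      intro b hb
      rw [ae_map_iff (by fun_prop) (by measurability)]
      filter_upwards [ih] with x hx
      refine ⟨h.mapsTo b x hx.1, ?_⟩
      have := h.mapsTo b _ hx.2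
      rw [wordRatio, ← hb]
      convert this using 1
      ring
    exact ae_add_measure_iff.2 ⟨key a rfl, key _ (her a)⟩

end SimSys

/-- The largest mass of an interval of length `l`. -/
noncomputable def concFun (m : Measure ℝ) (l : ℝ) : ENNReal := ⨆ x, m (Icc x (x + l))

theorem concLE_concFun (m : Measure ℝ) (l : ℝ) : ConcLE m l (concFun m l) :=
  fun x => le_iSup (fun x => m (Icc x (x + l))) x

theorem concFun_le_one (m : Measure ℝ) [IsProbabilityMeasure m] (l : ℝ) : concFun m l ≤ 1 :=
  iSup_le fun _ => prob_le_one

namespace SimSys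

variable {A : Type*} {μ : Measure ℝ} {r t p : A → ℝ} {ρ τ : ℝ} {u v : A} {g : ℝ}

theorem map_Icc_le_concFun (h : SimSys μ r t p ρ τ) (m : Measure ℝ) (a b : A) (hb : r b = r a)
    (l x : ℝ) :
    m.map (fun x => r b * x + t b) (Icc x (x + l)) ≤ concFun m (l / |r a|) := by
  rw [Measure.map_apply (by fun_prop) measurableSet_Icc]
  refine (concLE_concFun m _).measure_le fun y hy z hz => ?_
  rw [le_div_iff₀ (h.abs_pos a), ← hb, ← abs_mul, abs_le]
  constructor <;> linarith [hy.1, hy.2, hz.1, hz.2]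

theorem concFun_wordMeas_cons_le [DecidableEq A] (h : SimSys μ r t p ρ τ)
    (htw : IsTwin r t p u v g) (a : A) (w : List A) {l : ℝ} (hl : l < g) :
    concFun (wordMeas r t (Equiv.swap u v) (a :: w)) l ≤ (if a = u ∨ a = v then 2⁻¹ else 1) *
      concFun (wordMeas r t (Equiv.swap u v) w) (l / |r a|) := by
  have her : ∀ a, r (Equiv.swap u v a) = r a := Equiv.apply_swap_eq_self htw.r_eq
  refine iSup_le fun x => ?_
  rw [wordMeas, Measure.smul_apply, Measure.add_apply, smul_eq_mul]
  set m := wordMeas r t (Equiv.swap u v) w with hm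
  have h1 := h.map_Icc_le_concFun m a a rfl l x
  have h2 := h.map_Icc_le_concFun m a _ (her a) l x
  have hsupp := h.ae_wordMeas (Equiv.swap u v) her w
  split_ifs with ha
  · gcongr
    have hsep : ∀ y ∈ Icc (0 : ℝ) 1, ∀ z ∈ Icc (0 : ℝ) 1, g ≤ |r a * y + t a -
        (r (Equiv.swap u v a) * z + t (Equiv.swap u v a))| := by
      rcases ha with rfl | rfl
      · rw [Equiv.swap_apply_left]
        exact htw.gap_le
      · rw [Equiv.swap_apply_right]
        exact htw.symm.gap_le
    have hzero : ∀ b, (∀ y ∈ Icc (0 : ℝ) 1, r b * y + t b ∉ Icc x (x + l)) →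
        m.map (fun x => r b * x + t b) (Icc x (x + l)) = 0 := by
      intro b hb
      rw [Measure.map_apply (by fun_prop) measurableSet_Icc]
      refine measure_mono_null (fun y hy => ?_) hsupp
      exact fun hy' => hb y hy'.1 hy
    by_cases hx : ∃ y ∈ Icc (0 : ℝ) 1, r a * y + t a ∈ Icc x (x + l)
    · obtain ⟨y, hy, hyx⟩ := hx
      rw [hzero (Equiv.swap u v a), add_zero]
      · exact h1
      · intro z hz hzx
        have h3 := hsep y hy z hz
        have h4 : |r a * y + t a - (r (Equiv.swap u v a) * z + t (Equiv.swap u v a))| ≤ l := by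
          rw [abs_le]
          constructor <;> linarith [hyx.1, hyx.2, hzx.1, hzx.2]
        linarith
    · rw [hzero a fun y hy hyx => hx ⟨y, hy, hyx⟩, zero_add]
      exact h2
  · calc _ ≤ 2⁻¹ * (concFun m (l / |r a|) + concFun m (l / |r a|)) := by gcongr
      _ = _ := by
        rw [← two_mul, ← mul_assoc, ENNReal.inv_mul_cancel (by simp) (by simp)]

/-- On average, the stopped discrete measures have positive dimension above the stopping scale. -/
theorem lintegral_concFun_le [DecidableEq A] (h : SimSys μ r t p ρ τ) (hρ : 0 < ρ) (hρ1 : ρ < 1)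
    (hτ : 0 < τ) (htw : IsTwin r t p u v g) :
    ∃ s C : ℝ, 0 < s ∧ s ≤ 1 ∧ 0 < C ∧ ∀ (n : ℕ) (x l : ℝ), ρ ^ n ≤ x → x ≤ l →
      ∫⁻ w, concFun (wordMeas r t (Equiv.swap u v) w) l ∂stopMeas r p n x ≤
        ENNReal.ofReal (C * l ^ s) := by
  set c : A → ℝ := fun a => if a = u ∨ a = v then 2⁻¹ * p a else p a with hc
  have hc0 : ∀ a, 0 ≤ c a := fun a => by
    have := (h.p_pos a).le
    simp only [hc]; split_ifs <;> positivity
  have hcp : ∀ a, c a ≤ p a := fun a => by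
    have := (h.p_pos a).le
    simp only [hc]; split_ifs <;> linarith
  obtain ⟨s₀, hs₀, hs₀τ, hs⟩ := h.exists_small_exponent hρ1 hτ hc0 hcp
    (h.tsum_ite_lt_one _ (by norm_num) (by norm_num))
  set s := min 1 s₀ with hsdef
  have hs0 : 0 < s := lt_min one_pos hs₀
  have hs1 := hs s hs0 (min_le_right _ _)
  have hgp := htw.gap_pos
  set C := max 1 (g ^ (-s)) with hC
  have hC1 : 1 ≤ C := le_max_left _ _
  refine ⟨s, C, hs0, min_le_left _ _, by positivity, ?_⟩
  intro n
  have hbase : ∀ (l : ℝ) (w : List A), 1 ≤ l →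
      concFun (wordMeas r t (Equiv.swap u v) w) l ≤ ENNReal.ofReal (C * l ^ s) := by
    intro l w hl
    refine (concFun_le_one _ _).trans (ENNReal.one_le_ofReal.2 ?_)
    have : 1 ≤ l ^ s := Real.one_le_rpow hl hs0.le
    nlinarith
  induction n with
  | zero =>
    intro x l hx hl
    rw [lintegral_stopMeas_of_le 0 (.inl rfl)]
    exact hbase l _ (by simpa using hx.trans hl)
  | succ n ih =>
    intro x l hx hl
    have hx0 : 0 < x := (by positivity : 0 < ρ ^ (n + 1)).trans_le hx
    have hl0 : 0 < l := hx0.trans_le hl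
    rcases le_or_gt 1 x with hx1 | hx1
    · rw [lintegral_stopMeas_of_le _ (.inr hx1)]
      exact hbase l _ (hx1.trans hl)
    rcases le_or_gt g l with hlg | hlg
    · have := h.isProbabilityMeasure_stopMeas (n + 1) x
      calc _ ≤ ∫⁻ _, 1 ∂stopMeas r p (n + 1) x := lintegral_mono fun w => concFun_le_one _ _
        _ = 1 := by simp
        _ ≤ _ := by
          refine ENNReal.one_le_ofReal.2 ?_
          calc (1 : ℝ) = g ^ (-s) * g ^ s := by
                rw [← Real.rpow_add hgp, neg_add_cancel, Real.rpow_zero]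
            _ ≤ C * l ^ s := by
                gcongr
                exact le_max_right _ _
    · rw [lintegral_stopMeas_succ n hx1]
      have hterm : ∀ a, ENNReal.ofReal (p a) *
          ∫⁻ w, concFun (wordMeas r t (Equiv.swap u v) (a :: w)) l ∂stopMeas r p n (x / |r a|) ≤
          ENNReal.ofReal (C * l ^ s * (c a * |r a| ^ (-s))) := by
        intro a
        have hra := h.abs_pos a
        have hpa := h.p_pos a
        have h1 := ih (x / |r a|) (l / |r a|) (h.lt_div (by rwa [← pow_succ']) (by positivity) a)
          (by gcongr)
        calc _ ≤ ENNReal.ofReal (p a) * ((if a = u ∨ a = v then 2⁻¹ else 1) *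
              ENNReal.ofReal (C * (l / |r a|) ^ s)) := by
              gcongr
              refine le_trans ?_ (mul_le_mul_right h1 _)
              rw [← lintegral_const_mul _ measurable_from_top]
              exact lintegral_mono fun w => h.concFun_wordMeas_cons_le htw a w hlg
          _ = ENNReal.ofReal (c a) * ENNReal.ofReal (C * (l / |r a|) ^ s) := by
              rw [← mul_assoc]
              congr 1
              simp only [hc]
              split_ifs
              · rw [mul_comm, ENNReal.ofReal_mul (by norm_num), ENNReal.ofReal_inv_of_pos two_pos,
                  ENNReal.ofReal_ofNat]
              · rw [mul_one]
          _ = _ := by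
              rw [← ENNReal.ofReal_mul (hc0 a), Real.div_rpow hl0.le hra.le, Real.rpow_neg hra.le]
              congr 1
              ring
      refine (ENNReal.tsum_le_tsum hterm).trans ?_
      have hsum := (h.summable_rpow hρ1 hc0 hcp ((min_le_right 1 s₀).trans hs₀τ)).hasSum.mul_left
        (C * l ^ s)
      rw [← ENNReal.ofReal_tsum_of_nonneg _ hsum.summable, hsum.tsum_eq]
      · refine ENNReal.ofReal_le_ofReal (mul_le_of_le_one_right (by positivity) hs1.le)
      · intro a
        have := hc0 a
        positivity

end SimSys

/-! ### Linearisation -/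

/-- `G` and `H` are the first two derivatives of `F` on `[0,1]`, with the stated bounds. -/
structure C2Bounds (F G H : ℝ → ℝ) (M₁ M₂ m : ℝ) : Prop where
  deriv₁ : ∀ x ∈ Icc (0 : ℝ) 1, HasDerivWithinAt F (G x) (Icc 0 1) x
  deriv₂ : ∀ x ∈ Icc (0 : ℝ) 1, HasDerivWithinAt G (H x) (Icc 0 1) x
  le₁ : ∀ x ∈ Icc (0 : ℝ) 1, |G x| ≤ M₁
  le₂ : ∀ x ∈ Icc (0 : ℝ) 1, |H x| ≤ M₂
  ge₂ : ∀ x ∈ Icc (0 : ℝ) 1, m ≤ |H x|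

namespace C2Bounds

variable {F G H : ℝ → ℝ} {M₁ M₂ m : ℝ}

theorem continuousOn (h : C2Bounds F G H M₁ M₂ m) : ContinuousOn F (Icc 0 1) :=
  fun x hx => (h.deriv₁ x hx).continuousWithinAt

theorem continuousOn' (h : C2Bounds F G H M₁ M₂ m) : ContinuousOn G (Icc 0 1) :=
  fun x hx => (h.deriv₂ x hx).continuousWithinAt

theorem nonneg₁ (h : C2Bounds F G H M₁ M₂ m) : 0 ≤ M₁ :=
  (abs_nonneg _).trans (h.le₁ 0 (by simp))

theorem nonneg₂ (h : C2Bounds F G H M₁ M₂ m) : 0 ≤ M₂ :=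
  (abs_nonneg _).trans (h.le₂ 0 (by simp))

theorem abs_sub_sub_le (h : C2Bounds F G H M₁ M₂ m) {x y : ℝ} (hx : x ∈ Icc (0 : ℝ) 1)
    (hy : y ∈ Icc (0 : ℝ) 1) : |F y - F x - G x * (y - x)| ≤ M₂ * (y - x) ^ 2 := by
  have hG : ∀ z ∈ Icc (0 : ℝ) 1, |G z - G x| ≤ M₂ * |z - x| := fun z hz =>
    (convex_Icc (0 : ℝ) 1).norm_image_sub_le_of_norm_hasDerivWithin_le h.deriv₂ h.le₂ hx hz
  have hsub : uIcc x y ⊆ Icc (0 : ℝ) 1 := ordConnected_Icc.uIcc_subset hx hy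
  have h1 := (convex_uIcc x y).norm_image_sub_le_of_norm_hasDerivWithin_le
    (f := fun z => F z - G x * z) (f' := fun z => G z - G x) (C := M₂ * |y - x|)
    (fun z hz => by
      have h2 : HasDerivWithinAt (fun z => F z - G x * z) (G z - G x * 1) (uIcc x y) z :=
        ((h.deriv₁ z (hsub hz)).mono hsub).sub
          ((hasDerivWithinAt_id z (uIcc x y)).const_mul (G x))
      simpa using h2)
    (fun z hz => (hG z (hsub hz)).trans (mul_le_mul_of_nonneg_left
      (abs_sub_left_of_mem_uIcc hz) h.nonneg₂))
    left_mem_uIcc right_mem_uIcc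
  rw [Real.norm_eq_abs, Real.norm_eq_abs, mul_assoc, ← sq, sq_abs] at h1
  convert h1 using 2
  ring

theorem mul_abs_sub_le (h : C2Bounds F G H M₁ M₂ m) {x y : ℝ} (hx : x ∈ Icc (0 : ℝ) 1)
    (hy : y ∈ Icc (0 : ℝ) 1) : m * |x - y| ≤ |G x - G y| := by
  wlog hxy : x < y generalizing x y
  · rcases (not_lt.1 hxy).eq_or_lt with rfl | hlt
    · simp
    · rw [abs_sub_comm x, abs_sub_comm (G x)]
      exact this hy hx hlt
  have hsub : Icc x y ⊆ Icc (0 : ℝ) 1 := Icc_subset_Icc hx.1 hy.2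
  obtain ⟨c, hc, hc'⟩ := exists_hasDerivAt_eq_slope G H hxy (h.continuousOn'.mono hsub)
    fun z hz => (h.deriv₂ z (hsub (Ioo_subset_Icc_self hz))).hasDerivAt
      (Icc_mem_nhds (hx.1.trans_lt hz.1) (hz.2.trans_le hy.2))
  have h0 : y - x ≠ 0 := by linarith
  rw [eq_div_iff h0] at hc'
  rw [abs_sub_comm x, abs_sub_comm (G x), ← hc', abs_mul]
  gcongr
  exact h.ge₂ c (hsub (Ioo_subset_Icc_self hc))

end C2Bounds

/-- The extension of a function on `[0,1]` by constants. -/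
noncomputable def extend01 (F : ℝ → ℝ) (x : ℝ) : ℝ := F (projIcc 0 1 zero_le_one x)

theorem extend01_eq (F : ℝ → ℝ) {x : ℝ} (hx : x ∈ Icc (0 : ℝ) 1) : extend01 F x = F x := by
  rw [extend01, projIcc_of_mem zero_le_one hx]

theorem continuous_extend01 {F : ℝ → ℝ} (hF : ContinuousOn F (Icc 0 1)) :
    Continuous (extend01 F) :=
  hF.comp_continuous (by fun_prop) fun x => (projIcc 0 1 zero_le_one x).2

section

variable {F G H : ℝ → ℝ} {M₁ M₂ m : ℝ} {μ : Measure ℝ} [IsProbabilityMeasure μ]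

theorem C2Bounds.enorm_integral_le (h : C2Bounds F G H M₁ M₂ m)
    (hμ : ∀ᵐ y ∂μ, y ∈ Icc (0 : ℝ) 1) (ξ : ℝ) {z R : ℝ} (hz : z ∈ Icc (0 : ℝ) 1)
    (hzR : z + R ∈ Icc (0 : ℝ) 1) :
    ‖∫ y, ch (ξ * extend01 F (z + R * y)) ∂μ‖ₑ ≤
      ENNReal.ofReal (2 * Real.pi * |ξ| * (M₂ * R ^ 2)) +
        fourierAbs μ (ξ * R * extend01 G z) := by
  have hFc := continuous_extend01 h.continuousOn
  have hlin : ∫ y, ch (ξ * F z + ξ * R * extend01 G z * y) ∂μ =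
      ch (ξ * F z) * ∫ y, ch (ξ * R * extend01 G z * y) ∂μ := by
    simp_rw [ch_add]
    exact integral_const_mul _ _
  have hi : ∀ f : ℝ → ℝ, Continuous f → Integrable (fun y => ch (f y)) μ := fun f hf =>
    Integrable.of_bound (continuous_ch.comp hf).aestronglyMeasurable 1
      (Filter.Eventually.of_forall fun y => (norm_ch _).le)
  have hdiff : ‖∫ y, ch (ξ * extend01 F (z + R * y)) ∂μ -
      ∫ y, ch (ξ * F z + ξ * R * extend01 G z * y) ∂μ‖ ≤ 2 * Real.pi * |ξ| * (M₂ * R ^ 2) := by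
    rw [← integral_sub (hi _ (by fun_prop)) (hi _ (by fun_prop))]
    refine (norm_integral_le_of_norm_le_const (C := 2 * Real.pi * |ξ| * (M₂ * R ^ 2)) ?_).trans
      (by simp)
    filter_upwards [hμ] with y hy
    have hzy : z + R * y ∈ Icc (0 : ℝ) 1 := by
      have := (convex_Icc (0 : ℝ) 1) hz hzR (sub_nonneg.2 hy.2) hy.1 (by ring)
      simp only [smul_eq_mul] at this
      convert this using 1
      ring
    refine (norm_ch_sub_le _ _).trans ?_
    rw [mul_assoc (2 * Real.pi) |ξ|]
    refine mul_le_mul_of_nonneg_left ?_ Real.two_pi_pos.le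
    rw [extend01_eq F hzy, extend01_eq G hz]
    have h1 := h.abs_sub_sub_le hz hzy
    rw [add_sub_cancel_left, mul_pow] at h1
    have h2 : ξ * F (z + R * y) - (ξ * F z + ξ * R * G z * y) =
        ξ * (F (z + R * y) - F z - G z * (R * y)) := by ring
    rw [h2, abs_mul]
    gcongr
    refine h1.trans ?_
    have : y ^ 2 ≤ 1 := pow_le_one₀ hy.1 hy.2
    have := h.nonneg₂
    gcongr
    exact mul_le_of_le_one_right (sq_nonneg R) ‹_›
  have h3 : ‖∫ y, ch (ξ * F z + ξ * R * extend01 G z * y) ∂μ‖ₑ =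
      fourierAbs μ (ξ * R * extend01 G z) := by
    rw [hlin, enorm_mul, ← ofReal_norm, norm_ch, ENNReal.ofReal_one, one_mul, fourierAbs]
  rw [← h3]
  calc _ = ‖(∫ y, ch (ξ * extend01 F (z + R * y)) ∂μ -
      ∫ y, ch (ξ * F z + ξ * R * extend01 G z * y) ∂μ) +
        ∫ y, ch (ξ * F z + ξ * R * extend01 G z * y) ∂μ‖ₑ := by rw [sub_add_cancel]
    _ ≤ _ := by
      refine (enorm_add_le _ _).trans ?_
      gcongr
      rw [← ofReal_norm]
      exact ENNReal.ofReal_le_ofReal hdiff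

theorem C2Bounds.enorm_integral_integral_le (h : C2Bounds F G H M₁ M₂ m)
    (hμ : ∀ᵐ y ∂μ, y ∈ Icc (0 : ℝ) 1) (ξ : ℝ) {R : ℝ} {ν : Measure ℝ} [IsProbabilityMeasure ν]
    (hν : ∀ᵐ z ∂ν, z ∈ Icc (0 : ℝ) 1 ∧ z + R ∈ Icc (0 : ℝ) 1) :
    ‖∫ z, ∫ y, ch (ξ * extend01 F (z + R * y)) ∂μ ∂ν‖ₑ ≤
      ENNReal.ofReal (2 * Real.pi * |ξ| * (M₂ * R ^ 2)) +
        ∫⁻ s, fourierAbs μ s ∂ν.map fun z => ξ * R * extend01 G z := by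
  have hGc := continuous_extend01 h.continuousOn'
  rw [lintegral_map (measurable_fourierAbs μ) (by fun_prop)]
  calc _ ≤ ∫⁻ z, ‖∫ y, ch (ξ * extend01 F (z + R * y)) ∂μ‖ₑ ∂ν :=
        enorm_integral_le_lintegral_enorm _
    _ ≤ ∫⁻ z, (ENNReal.ofReal (2 * Real.pi * |ξ| * (M₂ * R ^ 2)) +
        fourierAbs μ (ξ * R * extend01 G z)) ∂ν := by
        refine lintegral_mono_ae ?_
        filter_upwards [hν] with z hz
        exact h.enorm_integral_le hμ ξ hz.1 hz.2
    _ = _ := by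
        rw [lintegral_add_left measurable_const, lintegral_const, measure_univ, mul_one]

theorem C2Bounds.concLE_map (h : C2Bounds F G H M₁ M₂ m) (hm : 0 < m) {R ξ l l' : ℝ}
    (hξ : ξ ≠ 0) (hR : R ≠ 0) {ν : Measure ℝ} (hν : ∀ᵐ z ∂ν, z ∈ Icc (0 : ℝ) 1)
    (hl : l' ≤ |ξ| * |R| * m * l) :
    ConcLE (ν.map fun z => ξ * R * extend01 G z) l' (concFun ν l) := by
  intro x
  have hGc := continuous_extend01 h.continuousOn'
  rw [Measure.map_apply (by fun_prop) measurableSet_Icc]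
  calc _ ≤ ν ((fun z => ξ * R * extend01 G z) ⁻¹' Icc x (x + l') ∩ Icc 0 1) := by
        refine measure_mono_ae ?_
        filter_upwards [hν] with z hz hz'
        exact ⟨hz', hz⟩
    _ ≤ _ := by
        refine (concLE_concFun ν l).measure_le fun y hy z hz => ?_
        have h1 := h.mul_abs_sub_le hy.2 hz.2
        have h2 := hy.1
        have h3 := hz.1
        rw [mem_preimage, extend01_eq G hy.2] at h2
        rw [mem_preimage, extend01_eq G hz.2] at h3
        have hξR : 0 < |ξ| * |R| := mul_pos (abs_pos.2 hξ) (abs_pos.2 hR)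
        have h4 : |ξ| * |R| * |G y - G z| ≤ l' := by
          rw [← abs_mul, ← abs_mul, mul_sub, abs_le]
          constructor <;> linarith [h2.1, h2.2, h3.1, h3.2]
        have h5 : |ξ| * |R| * (m * |y - z|) ≤ |ξ| * |R| * (m * l) :=
          calc _ ≤ |ξ| * |R| * |G y - G z| := by gcongr
            _ ≤ _ := h4.trans (hl.trans (le_of_eq (by ring)))
        exact le_of_mul_le_mul_left (le_of_mul_le_mul_left h5 hξR) hm

end

/-! ### The main estimate -/

theorem lintegral_rpow_mul_rpow_le {Ω : Type*} [MeasurableSpace Ω] {P : Measure Ω}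
    [IsProbabilityMeasure P] {O : Ω → ℝ} {f : Ω → ENNReal} (hO : Measurable O) (hf : Measurable f)
    (hO1 : ∀ᵐ w ∂P, 1 ≤ O w) {q τ : ℝ} (hq : 2 ≤ q) (hqτ : 4 / q ≤ τ) :
    ∫⁻ w, ENNReal.ofReal (O w ^ (2 / q)) * f w ^ (1 / q) ∂P ≤
      (∫⁻ w, ENNReal.ofReal (O w ^ τ) ∂P) ^ (1 / 2 : ℝ) * (∫⁻ w, f w ∂P) ^ (1 / q) := by
  have hq0 : 0 < q := by linarith
  have h1 : ∫⁻ w, ENNReal.ofReal (O w ^ (2 / q)) * f w ^ (1 / q) ∂P ≤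
      ∫⁻ w, ENNReal.ofReal (O w ^ τ) ^ (1 / 2 : ℝ) * (f w ^ (2 / q)) ^ (1 / 2 : ℝ) ∂P := by
    refine lintegral_mono_ae ?_
    filter_upwards [hO1] with w hw
    have hw0 : 0 ≤ O w := by linarith
    gcongr
    · rw [ENNReal.ofReal_rpow_of_nonneg (by positivity) (by norm_num), ← Real.rpow_mul hw0]
      refine ENNReal.ofReal_le_ofReal (Real.rpow_le_rpow_of_exponent_le hw ?_)
      have : 2 / q = 4 / q * (1 / 2) := by ring
      linarith
    · rw [← ENNReal.rpow_mul]
      refine le_of_eq ?_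
      congr 1
      ring
  refine h1.trans ((ENNReal.lintegral_mul_norm_pow_le (by fun_prop) (by fun_prop) (by norm_num)
    (by norm_num) (by norm_num)).trans ?_)
  gcongr
  calc (∫⁻ w, f w ^ (2 / q) ∂P) ^ (1 / 2 : ℝ) ≤ ((∫⁻ w, f w ∂P) ^ (2 / q)) ^ (1 / 2 : ℝ) := by
        gcongr
        exact lintegral_rpow_le_rpow_lintegral prob_le_one (by positivity)
          (by rw [div_le_one hq0]; exact hq) hf.aemeasurable
    _ = _ := by
        rw [← ENNReal.rpow_mul]
        congr 1
        ring

theorem SimSys.wordRatio_ne_zero {A : Type*} {μ : Measure ℝ} {r t p : A → ℝ} {ρ τ : ℝ}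
    (h : SimSys μ r t p ρ τ) (w : List A) : wordRatio r w ≠ 0 := by
  induction w with
  | nil => exact one_ne_zero
  | cons a w ih => exact mul_ne_zero (h.r_ne a) ih

/-- The combination of linearisation, the Erdős–Kahane estimate and the dimension estimate, at
stopping scale `x` and concentration scale `l`. -/
theorem SimSys.exists_integral_le {A : Type*} [Countable A] {μ : Measure ℝ}
    [IsProbabilityMeasure μ] {r t p : A → ℝ} {ρ τ : ℝ} {u v : A} {g : ℝ}
    (h : SimSys μ r t p ρ τ) (hρ : 0 < ρ) (hρ1 : ρ < 1) (hτ : 0 < τ)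
    (htw : IsTwin r t p u v g) (hμ : ∀ᵐ y ∂μ, y ∈ Icc (0 : ℝ) 1) :
    ∃ s q C : ℝ, 0 < s ∧ s ≤ 1 ∧ 2 ≤ q ∧ 0 < C ∧
      ∀ (F G H : ℝ → ℝ) (M₁ M₂ m : ℝ), C2Bounds F G H M₁ M₂ m → 0 < m →
        ∀ (ξ x l y : ℝ), ξ ≠ 0 → 0 < x → x ≤ 1 → x ≤ l → 1 ≤ |ξ| * x * m * l * 2 →
          0 < y → y ≤ 1 → y * (|ξ| * x * M₁) ≤ 1 →
          ‖∫ z, ch (ξ * F z) ∂μ‖ ≤ 2 * Real.pi * |ξ| * (M₂ * x ^ 2) +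
            C * y ^ (-(s / 16 / q)) * x ^ (-(s / 16 / q)) * l ^ (s / q) := by
  classical
  set e := Equiv.swap u v with he
  have hep : ∀ a, p (e a) = p a := Equiv.apply_swap_eq_self htw.p_eq
  have her : ∀ a, r (e a) = r a := Equiv.apply_swap_eq_self htw.r_eq
  obtain ⟨s, C₁, hs, hs1, hC₁, hconc⟩ := h.lintegral_concFun_le hρ hρ1 hτ htw
  obtain ⟨q₁, hq₁⟩ := exists_nat_ge (max 2 (4 / τ))
  obtain ⟨q, hqq, C₂, hC₂, hfour⟩ := h.exists_lintegral_fourierAbs_le hρ hρ1 hτ htw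
    (γ := s / 16) (by positivity) q₁
  have hqq' : (q₁ : ℝ) ≤ q := by exact_mod_cast hqq
  have hq2 : (2 : ℝ) ≤ q := ((le_max_left _ _).trans hq₁).trans hqq'
  have hq0 : (0 : ℝ) < q := by linarith
  have hq4 : 4 / (q : ℝ) ≤ τ := by
    rw [div_le_comm₀ hq0 hτ]
    exact ((le_max_right _ _).trans hq₁).trans hqq'
  set β : ℝ := 2 * (s / 16 / q) with hβ
  obtain ⟨K, hK, hover⟩ := h.lintegral_overshoot_le hρ hρ1 hτ (β := β) (by positivity)
  set C : ℝ := C₂ * ρ ^ (-(s / 16 / q)) * (1 / 2) ^ (-(2 / q : ℝ)) * (1 + K) ^ (1 / 2 : ℝ) *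
    C₁ ^ (1 / q : ℝ) with hC
  refine ⟨s, q, C, hs, hs1, hq2, by positivity, fun F G H M₁ M₂ m hF hm ξ x l y hξ hx hx1 hxl hl hy
    hy1 hyM => ?_⟩
  have hl0 : 0 < l := hx.trans_le hxl
  obtain ⟨n, hn⟩ := exists_pow_lt_of_lt_one hx hρ1
  obtain ⟨N, hN, hN'⟩ := exists_nat_pow_near_of_lt_one hy hy1 hρ hρ1
  have := h.isProbabilityMeasure_stopMeas n x
  have hFc := continuous_extend01 hF.continuousOn
  have hGc := continuous_extend01 hF.continuousOn'
  have hM₂ := hF.nonneg₂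
  have hM₁ := hF.nonneg₁
  have hint : ∫ z, ch (ξ * F z) ∂μ = ∫ z, ch (ξ * extend01 F z) ∂μ := by
    refine integral_congr_ae ?_
    filter_upwards [hμ] with z hz
    rw [extend01_eq F hz]
  have hρN : (ρ ^ (N + 1)) ^ (-(s / 16 / q)) ≤ ρ ^ (-(s / 16 / q)) * y ^ (-(s / 16 / q)) := by
    rw [← Real.mul_rpow hρ.le hy.le]
    refine Real.rpow_le_rpow_of_nonpos (by positivity) ?_ ?_
    · rw [pow_succ']
      gcongr
    · have : 0 < s / 16 / q := by positivity
      linarith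
  set D : ℝ := C₂ * (ρ ^ (-(s / 16 / q)) * y ^ (-(s / 16 / q))) * (1 / 2) ^ (-(2 / q : ℝ)) with hD
  have hword : ∀ᵐ w ∂stopMeas r p n x,
      ‖∫ z, ∫ y, ch (ξ * extend01 F (z + wordRatio r w * y)) ∂μ ∂wordMeas r t e w‖ₑ ≤
      ENNReal.ofReal (2 * Real.pi * |ξ| * (M₂ * x ^ 2)) + ENNReal.ofReal D *
        (ENNReal.ofReal ((x / |wordRatio r w|) ^ (2 / q : ℝ)) *
          concFun (wordMeas r t e w) l ^ (1 / q : ℝ)) := by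
    filter_upwards [h.ae_abs_wordRatio_le hρ n hn.le] with w hw
    set R := wordRatio r w with hR
    have hR0 : R ≠ 0 := h.wordRatio_ne_zero w
    have hRpos : 0 < |R| := _root_.abs_pos.2 hR0
    have hν := h.ae_wordMeas e her w
    refine (hF.enorm_integral_integral_le hμ ξ hν).trans (add_le_add ?_ ?_)
    · refine ENNReal.ofReal_le_ofReal ?_
      rw [← sq_abs R]
      gcongr
    · set ν := (wordMeas r t e w).map fun z => ξ * R * extend01 G z with hνdef
      have hν1 : ν univ ≤ 1 := by
        rw [hνdef, Measure.map_apply (by fun_prop) MeasurableSet.univ]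
        exact prob_le_one
      have hνs : ∀ᵐ s ∂ν, ρ ^ (N + 1) * |s| ≤ 1 := by
        rw [hνdef, ae_map_iff (by fun_prop) (measurableSet_le (by fun_prop) measurable_const)]
        filter_upwards [hν] with z hz
        rw [extend01_eq G hz.1, abs_mul, abs_mul]
        calc ρ ^ (N + 1) * (|ξ| * |R| * |G z|) ≤ y * (|ξ| * x * M₁) := by
              gcongr
              exact hF.le₁ z hz.1
          _ ≤ 1 := hyM
      have hνc : ConcLE ν (|R| / x / 2) (concFun (wordMeas r t e w) l) := by
        refine hF.concLE_map hm hξ hR0 (hν.mono fun z hz => hz.1) ?_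
        calc |R| / x / 2 = |R| / x / 2 * 1 := (mul_one _).symm
          _ ≤ |R| / x / 2 * (|ξ| * x * m * l * 2) := by gcongr
          _ = _ := by field_simp
      have hRx : |R| / x ≤ 1 := by rwa [div_le_one hx]
      refine (hfour ν (N + 1) (|R| / x / 2) _ hν1 (by positivity) (by linarith) hνs hνc).trans ?_
      rw [← mul_assoc, ← ENNReal.ofReal_mul (by positivity)]
      have h1 : (|R| / x / 2) ^ (-(2 / q : ℝ)) =
          (1 / 2) ^ (-(2 / q : ℝ)) * (x / |R|) ^ (2 / q : ℝ) := by
        rw [show |R| / x / 2 = 1 / 2 * (x / |R|)⁻¹ by field_simp,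
          Real.mul_rpow (by norm_num) (by positivity), Real.inv_rpow (by positivity),
          Real.rpow_neg (x := x / |R|) (by positivity), inv_inv]
      rw [h1, hD, ← mul_assoc]
      gcongr ENNReal.ofReal (?_ * _ * _) * _
      exact mul_le_mul_of_nonneg_left hρN hC₂.le
  have hO1 : ∀ᵐ w ∂stopMeas r p n x, 1 ≤ x / |wordRatio r w| := by
    filter_upwards [h.ae_abs_wordRatio_le hρ n hn.le] with w hw
    rwa [one_le_div (_root_.abs_pos.2 (h.wordRatio_ne_zero w))]
  have hav := lintegral_rpow_mul_rpow_le (P := stopMeas r p n x)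
    (O := fun w => x / |wordRatio r w|) (f := fun w => concFun (wordMeas r t e w) l)
    measurable_from_top measurable_from_top hO1 hq2 hq4
  have hov : ∫⁻ w, ENNReal.ofReal ((x / |wordRatio r w|) ^ τ) ∂stopMeas r p n x ≤
      ENNReal.ofReal ((1 + K) * x ^ (-β)) := by
    refine (hover n x hx).trans (ENNReal.ofReal_le_ofReal ?_)
    have h1 : x ^ τ ≤ 1 := Real.rpow_le_one hx.le hx1 hτ.le
    have h2 : 1 ≤ x ^ (-β) := Real.one_le_rpow_of_pos_of_le_one_of_nonpos hx hx1
      (by have : 0 < β := by positivity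
          linarith)
    linarith
  have hfin : ‖∫ z, ch (ξ * F z) ∂μ‖ₑ ≤ ENNReal.ofReal (2 * Real.pi * |ξ| * (M₂ * x ^ 2) +
      C * y ^ (-(s / 16 / q)) * x ^ (-(s / 16 / q)) * l ^ (s / q)) := by
    rw [hint]
    refine (h.enorm_integral_le_lintegral_stopMeas e hep her n x
      (f := fun z => ch (ξ * extend01 F z)) (by fun_prop) fun _ => (norm_ch _).le).trans ?_
    refine (lintegral_mono_ae hword).trans ?_
    rw [lintegral_add_left measurable_const, lintegral_const, measure_univ, mul_one,
      lintegral_const_mul _ measurable_from_top, ENNReal.ofReal_add (by positivity) (by positivity)]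
    gcongr
    calc _ ≤ ENNReal.ofReal D * (ENNReal.ofReal ((1 + K) * x ^ (-β)) ^ (1 / 2 : ℝ) *
          ENNReal.ofReal (C₁ * l ^ s) ^ (1 / q : ℝ)) := by
          gcongr
          refine hav.trans ?_
          gcongr
          exact hconc n x l hn.le hxl
      _ = _ := by
          have e1 : x ^ (-β * (1 / 2)) = x ^ (-(s / 16 / q)) := by
            congr 1
            rw [hβ]
            ring
          have e2 : l ^ (s * (1 / q)) = l ^ (s / q) := by
            congr 1
            ring
          rw [ENNReal.ofReal_rpow_of_nonneg (by positivity) (by norm_num),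
            ENNReal.ofReal_rpow_of_nonneg (by positivity) (by positivity),
            ← ENNReal.ofReal_mul (by positivity), ← ENNReal.ofReal_mul (by positivity),
            Real.mul_rpow (by positivity) (by positivity),
            Real.mul_rpow (by positivity) (by positivity), ← Real.rpow_mul hx.le,
            ← Real.rpow_mul hl0.le, e1, e2]
          congr 1
          rw [hC, hD]
          ring
  rw [← ofReal_norm] at hfin
  exact (ENNReal.ofReal_le_ofReal_iff (by positivity)).1 hfin

theorem SimSys.exists_decay {A : Type*} [Countable A] {μ : Measure ℝ}
    [IsProbabilityMeasure μ] {r t p : A → ℝ} {ρ τ : ℝ} {u v : A} {g : ℝ}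
    (h : SimSys μ r t p ρ τ) (hρ : 0 < ρ) (hρ1 : ρ < 1) (hτ : 0 < τ)
    (htw : IsTwin r t p u v g) (hμ : ∀ᵐ y ∂μ, y ∈ Icc (0 : ℝ) 1) :
    ∃ η κ C : ℝ, 0 < η ∧ 0 < κ ∧ 0 < C ∧
      ∀ (F G H : ℝ → ℝ) (M₁ M₂ m : ℝ), C2Bounds F G H M₁ M₂ m → 0 < m → ∀ ξ : ℝ, ξ ≠ 0 →
        ‖∫ z, ch (ξ * F z) ∂μ‖ ≤ C * (1 + M₁ + M₂) * (1 + m ^ (-κ)) * |ξ| ^ (-η) := by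
  obtain ⟨s, q, C₀, hs, hs1, hq, hC₀, hmain⟩ := h.exists_integral_le hρ hρ1 hτ htw hμ
  have hq0 : 0 < q := by linarith
  set κ := s / q with hκ
  have hκ0 : 0 < κ := by positivity
  have hκ1 : κ ≤ 1 := by
    rw [hκ, div_le_one hq0]
    linarith
  refine ⟨κ / 8, κ, 2 * Real.pi + C₀ + 1, by positivity, hκ0, by positivity,
    fun F G H M₁ M₂ m hF hm ξ hξ => ?_⟩
  have hM₁ := hF.nonneg₁
  have hM₂ := hF.nonneg₂
  have hξ0 : 0 < |ξ| := _root_.abs_pos.2 hξ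
  have hmκ : 0 < m ^ (-κ) := by positivity
  have hπ := Real.pi_pos
  rcases lt_or_ge |ξ| 1 with hξ1 | hξ1
  · have h1 : ‖∫ z, ch (ξ * F z) ∂μ‖ ≤ 1 := by
      simpa using norm_integral_le_of_norm_le_const (μ := μ)
        (Filter.Eventually.of_forall fun z => (norm_ch (ξ * F z)).le)
    have h2 : 1 ≤ |ξ| ^ (-(κ / 8)) :=
      Real.one_le_rpow_of_pos_of_le_one_of_nonpos hξ0 hξ1.le (by linarith)
    have h3 : 1 ≤ (2 * Real.pi + C₀ + 1) * (1 + M₁ + M₂) :=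
      one_le_mul_of_one_le_of_one_le (by linarith) (by linarith)
    exact h1.trans (one_le_mul_of_one_le_of_one_le
      (one_le_mul_of_one_le_of_one_le h3 (by linarith)) h2)
  set m' := min m 1 with hm'
  have hm'0 : 0 < m' := lt_min hm one_pos
  set x := |ξ| ^ (-(3 / 4) : ℝ) with hx
  set l := |ξ| ^ (-(1 / 4) : ℝ) / m' with hl
  have hx0 : 0 < x := by positivity
  have hxl : x ≤ l := by
    rw [hl, le_div_iff₀ hm'0]
    calc x * m' ≤ x * 1 := by gcongr; exact min_le_right _ _
      _ ≤ _ := by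
        rw [mul_one]
        exact Real.rpow_le_rpow_of_exponent_le hξ1 (by norm_num)
  have hx1 : x ≤ 1 := Real.rpow_le_one_of_one_le_of_nonpos hξ1 (by norm_num)
  have hlm : 1 ≤ |ξ| * x * m * l * 2 := by
    have h1 : |ξ| * x * |ξ| ^ (-(1 / 4) : ℝ) = 1 := by
      rw [hx]
      nth_rw 1 [← Real.rpow_one |ξ|]
      rw [← Real.rpow_add hξ0, ← Real.rpow_add hξ0]
      norm_num
    calc (1 : ℝ) ≤ 1 * (m / m') * 2 := by
          have : 1 ≤ m / m' := (one_le_div hm'0).2 (min_le_left _ _)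
          linarith
      _ = _ := by
          rw [← h1, hl]
          ring
  have hyM : ((1 + M₁) * |ξ|)⁻¹ * (|ξ| * x * M₁) ≤ 1 := by
    rw [inv_mul_le_iff₀ (by positivity), mul_one]
    have : x * M₁ ≤ 1 * M₁ := by gcongr
    calc |ξ| * x * M₁ = |ξ| * (x * M₁) := by ring
      _ ≤ |ξ| * (1 + M₁) := by gcongr; linarith
      _ = _ := mul_comm _ _
  have hy1 : ((1 + M₁) * |ξ|)⁻¹ ≤ 1 :=
    inv_le_one_of_one_le₀ (one_le_mul_of_one_le_of_one_le (by linarith) hξ1)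
  have hest := hmain F G H M₁ M₂ m hF hm ξ x l _ hξ hx0 hx1 hxl hlm (by positivity) hy1 hyM
  have hκ16 : s / 16 / q = κ / 16 := by
    rw [hκ]
    ring
  rw [hκ16] at hest
  have e1 : |ξ| * x ^ 2 ≤ |ξ| ^ (-(κ / 8)) := by
    rw [hx, ← Real.rpow_natCast, ← Real.rpow_mul hξ0.le]
    nth_rw 1 [← Real.rpow_one |ξ|]
    rw [← Real.rpow_add hξ0]
    refine Real.rpow_le_rpow_of_exponent_le hξ1 ?_
    push_cast
    linarith
  have e2 : (((1 + M₁) * |ξ|)⁻¹) ^ (-(κ / 16)) ≤ (1 + M₁) * |ξ| ^ (κ / 16) := by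
    rw [Real.inv_rpow (by positivity), Real.rpow_neg (by positivity), inv_inv,
      Real.mul_rpow (by positivity) (by positivity)]
    gcongr
    calc (1 + M₁) ^ (κ / 16) ≤ (1 + M₁) ^ (1 : ℝ) :=
          Real.rpow_le_rpow_of_exponent_le (by linarith) (by linarith)
      _ = _ := Real.rpow_one _
  have e3 : x ^ (-(κ / 16)) = |ξ| ^ (3 / 4 * (κ / 16)) := by
    rw [hx, ← Real.rpow_mul hξ0.le]
    congr 1
    ring
  have e4 : l ^ κ ≤ |ξ| ^ (-(1 / 4) * κ) * (1 + m ^ (-κ)) := by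
    rw [hl, Real.div_rpow (by positivity) hm'0.le, ← Real.rpow_mul hξ0.le, div_eq_mul_inv,
      ← Real.rpow_neg hm'0.le]
    gcongr
    rcases le_total m 1 with hm1 | hm1
    · rw [hm', min_eq_left hm1]
      linarith
    · rw [hm', min_eq_right hm1, Real.one_rpow]
      linarith
  have e5 : |ξ| ^ (κ / 16) * |ξ| ^ (3 / 4 * (κ / 16)) * |ξ| ^ (-(1 / 4) * κ) ≤
      |ξ| ^ (-(κ / 8)) := by
    rw [← Real.rpow_add hξ0, ← Real.rpow_add hξ0]
    exact Real.rpow_le_rpow_of_exponent_le hξ1 (by linarith)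
  set E := |ξ| ^ (-(κ / 8)) with hE
  have hE0 : 0 < E := by positivity
  calc _ ≤ 2 * Real.pi * M₂ * (|ξ| * x ^ 2) + C₀ * (((1 + M₁) * |ξ|)⁻¹) ^ (-(κ / 16)) *
        x ^ (-(κ / 16)) * l ^ κ := hest.trans (le_of_eq (by ring))
    _ ≤ 2 * Real.pi * M₂ * E + C₀ * ((1 + M₁) * |ξ| ^ (κ / 16)) * |ξ| ^ (3 / 4 * (κ / 16)) *
        (|ξ| ^ (-(1 / 4) * κ) * (1 + m ^ (-κ))) := by
        rw [e3]
        gcongr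
    _ = 2 * Real.pi * M₂ * E + C₀ * (1 + M₁) * (1 + m ^ (-κ)) *
        (|ξ| ^ (κ / 16) * |ξ| ^ (3 / 4 * (κ / 16)) * |ξ| ^ (-(1 / 4) * κ)) := by ring
    _ ≤ 2 * Real.pi * M₂ * E + C₀ * (1 + M₁) * (1 + m ^ (-κ)) * E := by gcongr
    _ ≤ 2 * Real.pi * (1 + M₁ + M₂) * (1 + m ^ (-κ)) * E +
        C₀ * (1 + M₁ + M₂) * (1 + m ^ (-κ)) * E + 1 * (1 + M₁ + M₂) * (1 + m ^ (-κ)) * E := by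
        have h1 : 2 * Real.pi * M₂ * E ≤ 2 * Real.pi * (1 + M₁ + M₂) * (1 + m ^ (-κ)) * E := by
          refine mul_le_mul_of_nonneg_right ?_ hE0.le
          rw [mul_assoc (2 * Real.pi) (1 + M₁ + M₂)]
          refine mul_le_mul_of_nonneg_left ?_ (by positivity)
          calc M₂ ≤ 1 + M₁ + M₂ := by linarith
            _ ≤ _ := le_mul_of_one_le_right (by positivity) (by linarith)
        have h2 : C₀ * (1 + M₁) * (1 + m ^ (-κ)) * E ≤
            C₀ * (1 + M₁ + M₂) * (1 + m ^ (-κ)) * E := by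
          gcongr C₀ * ?_ * _ * _
          linarith
        have h3 : 0 ≤ 1 * (1 + M₁ + M₂) * (1 + m ^ (-κ)) * E := by positivity
        linarith
    _ = _ := by ring

/-! ### Localisation to cylinders -/

theorem le_rpow_of_le_one_of_le {y z γ : ℝ} (hy : 0 ≤ y) (hy1 : y ≤ 1) (hyz : y ≤ z) (hγ : 0 < γ)
    (hγ1 : γ ≤ 1) : y ≤ z ^ γ := by
  calc y = y ^ (1 : ℝ) := (Real.rpow_one y).symm
    _ ≤ y ^ γ := Real.rpow_le_rpow_of_exponent_ge' hy hy1 hγ.le hγ1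
    _ ≤ z ^ γ := by gcongr

theorem norm_integral_ch_le_one {μ : Measure ℝ} [IsProbabilityMeasure μ] (f : ℝ → ℝ) :
    ‖∫ y, ch (f y) ∂μ‖ ≤ 1 := by
  simpa using norm_integral_le_of_norm_le_const (μ := μ)
    (Filter.Eventually.of_forall fun z => (norm_ch (f z)).le)

theorem C2Bounds.comp_affine {F G H : ℝ → ℝ} {M₁ M₂ m₀ m r t : ℝ} (h : C2Bounds F G H M₁ M₂ m₀)
    (hr : |r| ≤ 1) (hmaps : ∀ x ∈ Icc (0 : ℝ) 1, r * x + t ∈ Icc (0 : ℝ) 1)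
    (hm : ∀ x ∈ Icc (0 : ℝ) 1, m ≤ |H (r * x + t)|) :
    C2Bounds (fun x => F (r * x + t)) (fun x => r * G (r * x + t))
      (fun x => r ^ 2 * H (r * x + t)) M₁ M₂ (r ^ 2 * m) := by
  have haff : ∀ x, HasDerivWithinAt (fun x => r * x + t) r (Icc 0 1) x := fun x => by
    simpa using (((hasDerivAt_id x).const_mul r).add_const t).hasDerivWithinAt
  have hr2 : |r ^ 2| ≤ 1 := by
    rw [abs_pow]
    exact pow_le_one₀ (abs_nonneg _) hr
  refine ⟨fun x hx => ?_, fun x hx => ?_, fun x hx => ?_, fun x hx => ?_, fun x hx => ?_⟩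
  · have := (h.deriv₁ _ (hmaps x hx)).comp x (haff x) hmaps
    rw [mul_comm] at this
    exact this
  · have := ((h.deriv₂ _ (hmaps x hx)).comp x (haff x) hmaps).const_mul r
    rw [show r * (H (r * x + t) * r) = r ^ 2 * H (r * x + t) by ring] at this
    exact this
  · rw [abs_mul]
    exact (mul_le_of_le_one_left (abs_nonneg _) hr).trans (h.le₁ _ (hmaps x hx))
  · rw [abs_mul]
    exact (mul_le_of_le_one_left (abs_nonneg _) hr2).trans (h.le₂ _ (hmaps x hx))
  · rw [abs_mul, abs_of_nonneg (sq_nonneg r)]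
    exact mul_le_mul_of_nonneg_left (hm x hx) (sq_nonneg r)

theorem SimSys.norm_integral_le_of_cylinders {A : Type*} {μ : Measure ℝ} [IsProbabilityMeasure μ]
    {r t p : A → ℝ} {ρ τ η κ C γ : ℝ} (h : SimSys μ r t p ρ τ) (hρ1 : ρ ≤ 1)
    (hμ : ∀ᵐ y ∂μ, y ∈ Icc (0 : ℝ) 1) (hκ : 0 < κ) (hC : 0 < C)
    (hdecay : ∀ (F G H : ℝ → ℝ) (M₁ M₂ m : ℝ), C2Bounds F G H M₁ M₂ m → 0 < m → ∀ ξ : ℝ, ξ ≠ 0 →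
      ‖∫ z, ch (ξ * F z) ∂μ‖ ≤ C * (1 + M₁ + M₂) * (1 + m ^ (-κ)) * |ξ| ^ (-η))
    (hγ : 0 < γ) (hγ1 : γ ≤ 1) (hγτ : 2 * κ * γ ≤ τ) {F G H : ℝ → ℝ} {M₁ M₂ m₀ m : ℝ}
    (hF : C2Bounds F G H M₁ M₂ m₀) (hm : 0 < m)
    (hcyl : ∀ a, ∀ x ∈ Icc (0 : ℝ) 1, m ≤ |H (r a * x + t a)|) {ξ : ℝ} (hξ : ξ ≠ 0) :
    ‖∫ z, ch (ξ * F z) ∂μ‖ ≤ (∑' a, p a * |r a| ^ (-τ)) *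
      ((C * (1 + M₁ + M₂) * (1 + m ^ (-κ))) ^ γ * |ξ| ^ (-(η * γ))) := by
  have hFc := continuous_extend01 hF.continuousOn
  have hM₁ := hF.nonneg₁
  have hM₂ := hF.nonneg₂
  have hξ0 : 0 < |ξ| := _root_.abs_pos.2 hξ
  have hint : ∫ z, ch (ξ * F z) ∂μ = ∫ z, ch (ξ * extend01 F z) ∂μ := by
    refine integral_congr_ae ?_
    filter_upwards [hμ] with z hz
    rw [extend01_eq F hz]
  have hsum := h.hasSum_integral (f := fun z => ch (ξ * extend01 F z)) (by fun_prop)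
    fun z => (norm_ch _).le
  rw [hint, ← hsum.tsum_eq]
  refine tsum_of_norm_bounded (h.moment.hasSum.mul_right _) fun a => ?_
  have hra := h.abs_pos a
  have hra1 : |r a| ≤ 1 := (h.r_le a).trans hρ1
  have hpa := h.p_pos a
  rw [norm_mul, Complex.norm_real, Real.norm_of_nonneg hpa.le, mul_assoc]
  refine mul_le_mul_of_nonneg_left ?_ hpa.le
  have hint' : ∫ z, ch (ξ * extend01 F (r a * z + t a)) ∂μ =
      ∫ z, ch (ξ * F (r a * z + t a)) ∂μ := by
    refine integral_congr_ae ?_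
    filter_upwards [hμ] with z hz
    rw [extend01_eq F (h.mapsTo a z hz)]
  rw [hint']
  have h1 := hdecay _ _ _ _ _ _ (hF.comp_affine hra1 (h.mapsTo a) (hcyl a))
    (mul_pos (pow_pos hra 2 |>.trans_eq (sq_abs _)) hm) ξ hξ
  have h2 : (r a ^ 2 * m) ^ (-κ) = |r a| ^ (-(2 * κ)) * m ^ (-κ) := by
    rw [← sq_abs, Real.mul_rpow (by positivity) hm.le, ← Real.rpow_natCast,
      ← Real.rpow_mul hra.le]
    congr 2
    push_cast
    ring
  have h3 : 1 ≤ |r a| ^ (-(2 * κ)) :=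
    Real.one_le_rpow_of_pos_of_le_one_of_nonpos hra hra1 (by linarith)
  have h4 : ‖∫ z, ch (ξ * F (r a * z + t a)) ∂μ‖ ≤
      |r a| ^ (-(2 * κ)) * (C * (1 + M₁ + M₂) * (1 + m ^ (-κ)) * |ξ| ^ (-η)) := by
    refine h1.trans ?_
    rw [h2]
    calc C * (1 + M₁ + M₂) * (1 + |r a| ^ (-(2 * κ)) * m ^ (-κ)) * |ξ| ^ (-η) ≤
          C * (1 + M₁ + M₂) * (|r a| ^ (-(2 * κ)) + |r a| ^ (-(2 * κ)) * m ^ (-κ)) *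
            |ξ| ^ (-η) := by gcongr
      _ = _ := by ring
  refine (le_rpow_of_le_one_of_le (norm_nonneg _) (norm_integral_ch_le_one _) h4 hγ hγ1).trans ?_
  rw [Real.mul_rpow (by positivity) (by positivity), Real.mul_rpow (by positivity) (by positivity),
    ← Real.rpow_mul hra.le, ← Real.rpow_mul hξ0.le, neg_mul η]
  exact mul_le_mul_of_nonneg_right
    (Real.rpow_le_rpow_of_exponent_ge hra hra1 (by linarith)) (by positivity)

/-! ### Passage to measures on the unit interval -/

theorem IsProbVector.nonempty {A : Type*} {p : A → ℝ} (hp : IsProbVector p) : Nonempty A := by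
  by_contra hA
  rw [not_nonempty_iff] at hA
  exact one_ne_zero (hp.2.unique hasSum_empty)

theorem IsStationaryMeasure.exists_simSys {A : Type*} [Countable A] {φ : A → I → I} {r p : A → ℝ}
    (hφ : IsCIFS φ) (hsim : ∀ a, IsSimilarityWith (φ a) (r a)) (hp : IsProbVector p) {τ : ℝ}
    (hτ : Summable fun a => p a * |r a| ^ (-τ)) {μ : Measure I}
    (hμ : IsStationaryMeasure φ p μ) :
    ∃ (t : A → ℝ) (ρ : ℝ), 0 < ρ ∧ ρ < 1 ∧ (∀ a, ∀ x : I, (φ a x : ℝ) = r a * x + t a) ∧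
      SimSys (μ.map Subtype.val) r t p ρ τ := by
  obtain ⟨ρ, hρ⟩ := hφ
  choose h0 h1 t ht using hsim
  refine ⟨t, max ρ (1 / 2), by positivity, max_lt ?_ (by norm_num), ht, ?_⟩
  · obtain ⟨a⟩ := hp.nonempty
    exact_mod_cast (hρ a).1
  refine ⟨hp.1, hp.2, fun a => abs_pos.1 (h0 a), fun a => ?_, fun a x hx => ?_, hτ, fun S hS => ?_⟩
  · refine le_trans ?_ (le_max_left _ _)
    have := (hρ a).2.dist_le_mul (1 : I) 0
    rw [Subtype.dist_eq, Subtype.dist_eq, ht, ht, Real.dist_eq, Real.dist_eq] at this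
    simpa using this
  · rw [← ht a ⟨x, hx⟩]
    exact (φ a ⟨x, hx⟩).2
  · have hc : ∀ a, Measurable (φ a) := fun a => (hρ a).2.continuous.measurable
    rw [Measure.map_apply measurable_subtype_coe hS]
    conv_lhs => rw [hμ.2]
    rw [Measure.sum_apply _ (measurable_subtype_coe hS)]
    refine tsum_congr fun a => ?_
    rw [Measure.smul_apply, smul_eq_mul, Measure.map_apply (hc a) (measurable_subtype_coe hS),
      Measure.map_apply measurable_subtype_coe (by measurability)]
    congr 2
    ext x
    simp only [mem_preimage, ht]

theorem IsCIFS.exists_fixed {A : Type*} [Countable A] {φ : A → I → I} (hφ : IsCIFS φ) (a : A) :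
    ∃ x, φ a x = x := by
  obtain ⟨ρ, hρ⟩ := hφ
  exact ⟨_, (hρ a).fixedPoint_isFixedPt⟩

theorem measureFourier_pushforward {F : ℝ → ℝ} (hF : ContinuousOn F (Icc 0 1)) (μ : Measure I)
    (ξ : ℝ) : measureFourier (pushforward F μ) ξ = ∫ y, ch (ξ * F y) ∂μ.map Subtype.val := by
  have hFI : Continuous fun x : I => F x := continuousOn_iff_continuous_domRestrict.1 hF
  rw [(MeasurableEmbedding.subtype_coe measurableSet_Icc).integral_map, measureFourier, pushforward,
    integral_map hFI.aemeasurable (by fun_prop)]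
  refine integral_congr_ae (Filter.Eventually.of_forall fun x => ?_)
  simp only [ch]
  congr 1
  push_cast
  ring

section

variable {F : ℝ → ℝ}

theorem continuous_deriv₁ (hF : ContDiffOn ℝ 2 F (Icc 0 1)) : Continuous (deriv₁ F) :=
  continuousOn_iff_continuous_domRestrict.1
    (hF.continuousOn_derivWithin (uniqueDiffOn_Icc zero_lt_one) (by norm_num))

theorem contDiffOn_derivWithin (hF : ContDiffOn ℝ 2 F (Icc 0 1)) :
    ContDiffOn ℝ 1 (derivWithin F (Icc 0 1)) (Icc 0 1) :=
  hF.derivWithin (uniqueDiffOn_Icc zero_lt_one) (by norm_num)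

theorem continuous_deriv₂ (hF : ContDiffOn ℝ 2 F (Icc 0 1)) : Continuous (deriv₂ F) :=
  continuousOn_iff_continuous_domRestrict.1
    ((contDiffOn_derivWithin hF).continuousOn_derivWithin (uniqueDiffOn_Icc zero_lt_one) le_rfl)

theorem c2Bounds_of_contDiffOn (hF : ContDiffOn ℝ 2 F (Icc 0 1)) {m : ℝ}
    (hm : ∀ x : I, m ≤ |deriv₂ F x|) :
    C2Bounds F (derivWithin F (Icc 0 1)) (derivWithin (derivWithin F (Icc 0 1)) (Icc 0 1))
      (maxDeriv₁ F) (maxDeriv₂ F) m where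
  deriv₁ x hx := (hF.differentiableOn (by norm_num) x hx).hasDerivWithinAt
  deriv₂ x hx := ((contDiffOn_derivWithin hF).differentiableOn (by norm_num) x hx).hasDerivWithinAt
  le₁ x hx := le_ciSup (f := fun x : I => |deriv₁ F x|)
    (isCompact_range (continuous_deriv₁ hF).abs).bddAbove ⟨x, hx⟩
  le₂ x hx := le_ciSup (f := fun x : I => |deriv₂ F x|)
    (isCompact_range (continuous_deriv₂ hF).abs).bddAbove ⟨x, hx⟩
  ge₂ x hx := hm ⟨x, hx⟩

theorem minDeriv₂_le (x : I) : minDeriv₂ F ≤ |deriv₂ F x| :=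
  ciInf_le ⟨0, by rintro _ ⟨y, rfl⟩; exact abs_nonneg _⟩ x

theorem minDeriv₂_pos (hF : ContDiffOn ℝ 2 F (Icc 0 1)) (hF2 : ∀ x : I, deriv₂ F x ≠ 0) :
    0 < minDeriv₂ F := by
  obtain ⟨x, -, hx⟩ := isCompact_univ.exists_isMinOn univ_nonempty
    (continuous_deriv₂ hF).abs.continuousOn
  exact (abs_pos.2 (hF2 x)).trans_le (le_ciInf fun y => hx (mem_univ y))

end

theorem SimSys.mem_support {A : Type*} {μ : Measure I} {r t p : A → ℝ} {ρ τ : ℝ}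
    (h : SimSys (μ.map Subtype.val) r t p ρ τ) {x : I} (hx : x ∈ μ.support) (a : A) :
    (⟨r a * x + t a, h.mapsTo a x x.2⟩ : I) ∈ μ.support := by
  rw [Measure.mem_support_iff_forall] at hx ⊢
  intro U hU
  obtain ⟨V, hV, hVU⟩ := mem_nhds_subtype _ _ _ |>.1 hU
  obtain ⟨W, hWV, hWo, hW⟩ := mem_nhds_iff.1 hV
  have hcont : Continuous fun y : ℝ => r a * y + t a := by fun_prop
  have h1 : 0 < μ.map Subtype.val ((fun y => r a * y + t a) ⁻¹' W) := by
    rw [Measure.map_apply measurable_subtype_coe (hWo.preimage hcont).measurableSet]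
    exact hx _ (((hWo.preimage hcont).preimage continuous_subtype_val).mem_nhds hW)
  have h2 : 0 < μ.map Subtype.val W := by
    rw [h.stationary W hWo.measurableSet]
    refine lt_of_lt_of_le ?_ (ENNReal.le_tsum a)
    exact ENNReal.mul_pos (ENNReal.ofReal_pos.2 (h.p_pos a)).ne' h1.ne'
  rw [Measure.map_apply measurable_subtype_coe hWo.measurableSet] at h2
  exact h2.trans_le (measure_mono ((preimage_mono hWV).trans hVU))

theorem exists_forall_le_abs_of_support {μ : Measure I} {f : I → ℝ} (hf : Continuous f)
    (hμ : ∀ x ∈ μ.support, f x ≠ 0) :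
    ∃ m δ : ℝ, 0 < m ∧ 0 < δ ∧ ∀ x ∈ μ.support, ∀ y, dist y x < δ → m ≤ |f y| := by
  rcases μ.support.eq_empty_or_nonempty with he | hne
  · exact ⟨1, 1, one_pos, one_pos, by simp [he]⟩
  obtain ⟨x₀, hx₀, hmin⟩ := Measure.isClosed_support (μ := μ).isCompact.exists_isMinOn hne
    hf.abs.continuousOn
  have hpos : 0 < |f x₀| := abs_pos.2 (hμ x₀ hx₀)
  obtain ⟨δ, hδ, hδ'⟩ := Metric.uniformContinuous_iff.1
    (CompactSpace.uniformContinuous_of_continuous hf) (|f x₀| / 2) (by positivity)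
  refine ⟨|f x₀| / 2, δ, by positivity, hδ, fun x hx y hy => ?_⟩
  have h1 := hδ' hy
  have h2 : |f x₀| ≤ |f x| := hmin hx
  rw [Real.dist_eq] at h1
  have h3 := abs_sub_abs_le_abs_sub (f x) (f y)
  rw [abs_sub_comm] at h1
  linarith

theorem corollaryt {A : Type*} [Countable A] (φ : A → I → I) (r p : A → ℝ)
    (hφ : IsCIFS φ) (hsim : ∀ a, IsSimilarityWith (φ a) (r a)) (hnt : IsNontrivialIFS φ)
    (hp : IsProbVector p)
    (hτ : ∃ τ : ℝ, 0 < τ ∧ Summable (fun a => p a * |r a| ^ (-τ)))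
    (μ : Measure I) (hμ : IsStationaryMeasure φ p μ) :
    ∃ η κ C : ℝ, 0 < η ∧ 0 < κ ∧ 0 < C ∧
      (∀ F : ℝ → ℝ, ContDiffOn ℝ 2 F (Icc 0 1) → (∀ x : I, deriv₂ F x ≠ 0) →
        ∀ ξ : ℝ, ξ ≠ 0 →
          ‖measureFourier (pushforward F μ) ξ‖ ≤
            C * (1 + maxDeriv₁ F + maxDeriv₁ F ^ (-κ) + maxDeriv₂ F) *
              (1 + minDeriv₂ F ^ (-κ)) * |ξ| ^ (-η)) ∧
      (∀ F : ℝ → ℝ, ContDiffOn ℝ 2 F (Icc 0 1) → (∀ x ∈ μ.support, deriv₂ F x ≠ 0) →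
        ∃ C' : ℝ, 0 < C' ∧ ∀ ξ : ℝ, ξ ≠ 0 →
          ‖measureFourier (pushforward F μ) ξ‖ ≤ C' * |ξ| ^ (-η)) := by
  obtain ⟨τ, hτ0, hτs⟩ := hτ
  have hprob : IsProbabilityMeasure μ := hμ.1
  have hprob' : IsProbabilityMeasure (μ.map (Subtype.val : I → ℝ)) :=
    Measure.isProbabilityMeasure_map measurable_subtype_coe.aemeasurable
  have hsupp : ∀ᵐ y ∂μ.map (Subtype.val : I → ℝ), y ∈ Icc (0 : ℝ) 1 := by
    refine (ae_map_iff measurable_subtype_coe.aemeasurable measurableSet_Icc).2 ?_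
    exact Filter.Eventually.of_forall fun x => x.2
  obtain ⟨t, ρ, hρ, hρ1, ht, hsys⟩ := hμ.exists_simSys hφ hsim hp hτs
  obtain ⟨a⟩ := hp.nonempty
  obtain ⟨x₀, hx₀⟩ := hφ.exists_fixed a
  obtain ⟨b, hb⟩ : ∃ b, φ b x₀ ≠ x₀ := by
    by_contra! hcon
    exact hnt ⟨x₀, hcon⟩
  obtain ⟨y₀, hy₀⟩ := hφ.exists_fixed b
  have hne : (x₀ : ℝ) ≠ y₀ := fun heq => by
    rw [← Subtype.ext heq] at hy₀
    exact hb hy₀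
  obtain ⟨B, hB, r', t', p', ρ', hρ', hρ'1, hsys', u, v, g, htw⟩ := hsys.exists_twin hρ hρ1 a b
    x₀.2 y₀.2 hne (by rw [← ht, hx₀]) (by rw [← ht, hy₀])
  obtain ⟨η, κ, C, hη, hκ, hC, hdecay⟩ := hsys'.exists_decay hρ' hρ'1 hτ0 htw hsupp
  set γ := min 1 (τ / (2 * κ)) with hγdef
  have hγ : 0 < γ := lt_min one_pos (by positivity)
  have hγ1 : γ ≤ 1 := min_le_left _ _
  have hγτ : 2 * κ * γ ≤ τ := by
    have : γ ≤ τ / (2 * κ) := min_le_right _ _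
    rwa [le_div_iff₀' (by positivity)] at this
  refine ⟨η * γ, κ, C + 1, by positivity, hκ, by positivity, fun F hF hF2 ξ hξ => ?_,
    fun F hF hF2 => ?_⟩
  · have hξ0 : 0 < |ξ| := abs_pos.2 hξ
    have hbd := c2Bounds_of_contDiffOn hF minDeriv₂_le
    have hm := minDeriv₂_pos hF hF2
    have hM₁ := hbd.nonneg₁
    have hM₂ := hbd.nonneg₂
    have hmain := hdecay _ _ _ _ _ _ hbd hm ξ hξ
    rw [measureFourier_pushforward hF.continuousOn]
    have h1 : 0 ≤ maxDeriv₁ F ^ (-κ) := Real.rpow_nonneg hM₁ _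
    have h2 : 0 ≤ minDeriv₂ F ^ (-κ) := Real.rpow_nonneg hm.le _
    rcases lt_or_ge |ξ| 1 with hξ1 | hξ1
    · refine (norm_integral_ch_le_one _).trans ?_
      have h3 : 1 ≤ |ξ| ^ (-(η * γ)) :=
        Real.one_le_rpow_of_pos_of_le_one_of_nonpos hξ0 hξ1.le (by
          have := mul_pos hη hγ
          linarith)
      exact one_le_mul_of_one_le_of_one_le (one_le_mul_of_one_le_of_one_le
        (one_le_mul_of_one_le_of_one_le (by linarith) (by linarith)) (by linarith)) h3
    · refine hmain.trans ?_
      have h3 : |ξ| ^ (-η) ≤ |ξ| ^ (-(η * γ)) :=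
        Real.rpow_le_rpow_of_exponent_le hξ1 (neg_le_neg (mul_le_of_le_one_right hη.le hγ1))
      have h4 : 1 + maxDeriv₁ F + maxDeriv₂ F ≤
          1 + maxDeriv₁ F + maxDeriv₁ F ^ (-κ) + maxDeriv₂ F := by linarith
      gcongr
      linarith
  · obtain ⟨m, δ, hm, hδ, hmδ⟩ := exists_forall_le_abs_of_support (continuous_deriv₂ hF) hF2
    obtain ⟨N, hN⟩ := exists_pow_lt_of_lt_one hδ hρ1
    obtain ⟨B', hB', r'', t'', p'', hsys'', -⟩ := hsys.exists_pow a b N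
    obtain ⟨s, hs⟩ : μ.support.Nonempty := by
      rw [Measure.nonempty_support_iff]
      exact hprob.ne_zero
    have hcyl : ∀ c, ∀ x ∈ Icc (0 : ℝ) 1, m ≤ |derivWithin (derivWithin F (Icc 0 1)) (Icc 0 1)
        (r'' c * x + t'' c)| := by
      intro c x hx
      refine hmδ _ (hsys''.mem_support hs c) ⟨r'' c * x + t'' c, hsys''.mapsTo c x hx⟩ ?_
      rw [Subtype.dist_eq, Real.dist_eq, add_sub_add_right_eq_sub, ← mul_sub, abs_mul]
      refine lt_of_le_of_lt ?_ hN
      have h1 : |x - s| ≤ 1 := by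
        rw [abs_le]
        constructor <;> linarith [hx.1, hx.2, s.2.1, s.2.2]
      exact (mul_le_of_le_one_right (abs_nonneg _) h1).trans (hsys''.r_le c)
    have hbd := c2Bounds_of_contDiffOn hF (m := 0) fun x => abs_nonneg _
    have hM₁ := hbd.nonneg₁
    have hM₂ := hbd.nonneg₂
    set Z := ∑' c, p'' c * |r'' c| ^ (-τ) with hZ
    have hZ0 : 0 ≤ Z := tsum_nonneg fun c => mul_nonneg (hsys''.p_pos c).le (by positivity)
    set D := (C * (1 + maxDeriv₁ F + maxDeriv₂ F) * (1 + m ^ (-κ))) ^ γ with hD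
    have hD0 : 0 ≤ D := by positivity
    refine ⟨Z * D + 1, by positivity, fun ξ hξ => ?_⟩
    rw [measureFourier_pushforward hF.continuousOn]
    have hmain := hsys''.norm_integral_le_of_cylinders (pow_le_one₀ hρ.le hρ1.le) hsupp hκ hC hdecay
      hγ hγ1 hγτ hbd hm hcyl hξ
    refine hmain.trans ?_
    rw [← mul_assoc]
    gcongr
    linarith
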